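/- **Setting.** Polynomials over $\{-1,1\}^d$ are the functions $p(x)=\sum_{I\subseteq[d]}c_p(I)\prod_{i\in I}x_i$ with $c_p(I)\in\mathbb R$; $\deg p\le k$ means $c_p(I)=0$ whenever $|I|>k$, and $\|p\|_{\mathrm{coef}}=\sum_I|c_p(I)|$. In sets of examples, equal points count as separate instances. *Contamination.* $S_{\mathrm{cln}}$ consists of $N$ i.i.d. uniform points of $\{-1,1\}^d$. An adversary removes any $\lfloor\eta N\rfloor$ of them and substitutes them with a set $S_{\mathrm{adv}}$ of $\lfloor\eta N\rfloor$ arbitrary points of $\{-1,1\}^d$; the result is the $\eta$-contaminated uniform sample $S_{\mathrm{inp}}$. *Filtering algorithm*, with inputs $S_{\mathrm{inp}}$, $\varepsilon$, $k$ and a reference set $S_{\mathrm{ref}}$ of $N$ further i.i.d. uniform points of $\{-1,1\}^d$, independent of $S_{\mathrm{cln}}$. Let $B=3^kd^{k/2}$, $\Delta=\varepsilon/(2B)$ and $S^{(0)}=S_{\mathrm{inp}}$. For $i=0,1,\dots,N$: let $p^*$ be an optimal solution (any one) of the linear program that maximizes $\sum_{x\in S^{(i)}}p(x)$ over polynomials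 $p$ with $\deg p\le k$, $\|p\|_{\mathrm{coef}}\le B$, $p\ge0$ on $S_{\mathrm{ref}}\cup S_{\mathrm{inp}}$ and $\frac1N\sum_{x\in S_{\mathrm{ref}}}p(x)\le\varepsilon/4$. If $\frac1N\sum_{x\in S^{(i)}}p^*(x)\le\varepsilon$, output $S_{\mathrm{filt}}=S^{(i)}$ and stop. Otherwise let $\tau^*\ge0$ be the smallest value with $\frac{|S^{(i)}|}{N}\Pr_{x\sim S^{(i)}}[p^*(x)>\tau^*]\ge2\Pr_{x\sim S_{\mathrm{ref}}}[p^*(x)>\tau^*]+\Delta$, and set $S^{(i+1)}=S^{(i)}\setminus\{x\in S^{(i)}:p^*(x)>\tau^*\}$. **Lemma (Outlier removal).** There is an absolute constant $C\ge1$ such that the following holds for all $d,k,N\in\mathbb N$ and all $\varepsilon,\delta,\eta\in(0,1)$ with $$N\ \ge\ C\,\frac{(3d)^{2k}}{\varepsilon^2}\,\max\{1,\log(1/\delta)\}.$$ Whatever the input and reference samples and whichever optimal solutions are used, the filtering algorithm is well defined and stops with an output $S_{\mathrm{filt}}$ within its $N+1$ iterations. Moreover: 1. With probability at least $1-\delta$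 over $S_{\mathrm{cln}}$ and $S_{\mathrm{ref}}$, for every choice of the adversary and of the optimal solutions, the filter removes no more clean than adversarial examples: $|(S_{\mathrm{inp}}\cap S_{\mathrm{cln}})\setminus S_{\mathrm{filt}}|\le|S_{\mathrm{adv}}\setminus S_{\mathrm{filt}}|$. 2. With probability at least $1-\delta$ over $S_{\mathrm{cln}}$ and $S_{\mathrm{ref}}$, for every choice of the adversary and of the optimal solutions, every polynomial $p$ that is non-negative on $\{-1,1\}^d$, has degree at most $k$ and satisfies $\mathbb E_{x\sim\mathrm{Unif}(\{-1,1\}^d)}[p(x)]\le\varepsilon/8$ also satisfies $\sum_{x\in S_{\mathrm{filt}}}p(x)\le\varepsilon N$. -/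

import Mathlib

namespace OutlierRemoval

/-- The hypercube `{-1, 1}^d`. -/
abbrev Cube (d : ℕ) : Type := Fin d → ℤˣ

/-- A polynomial over the cube, given by its coefficients: `c` stands for `∑ I, c I * x^I`, where
`I` ranges over the subsets of the coordinates and `x^I = ∏ i ∈ I, x i`. -/
abbrev CubePoly (d : ℕ) : Type := Finset (Fin d) → ℝ

/-- The value of the polynomial at a point of the cube. -/
noncomputable def evalAt {d : ℕ} (p : CubePoly d) (x : Cube d) : ℝ :=
  ∑ I : Finset (Fin d), p I * ∏ i ∈ I, (((x i : ℤˣ) : ℤ) : ℝ)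

/-- The degree of the polynomial is at most `k`. -/
def DegLE {d : ℕ} (k : ℕ) (p : CubePoly d) : Prop :=
  ∀ I : Finset (Fin d), k < I.card → p I = 0

/-- The `ℓ₁` norm of the coefficients. -/
noncomputable def coefNorm {d : ℕ} (p : CubePoly d) : ℝ :=
  ∑ I : Finset (Fin d), |p I|

/-- The expectation of the polynomial under the uniform distribution over the cube. -/
noncomputable def unifMean {d : ℕ} (p : CubePoly d) : ℝ :=
  (∑ x : Cube d, evalAt p x) / (Fintype.card (Cube d) : ℝ)

/-- A sample of `N` points of the cube. The indices make equal points separate instances; sets of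
examples are sets of indices. -/
abbrev Sample (N d : ℕ) : Type := Fin N → Cube d

/-- `inp` arises from the clean sample `cln` when an adversary removes the `⌊η N⌋` examples with
index in `R` and substitutes them with arbitrary points. So the clean examples that survive in the
input are those with index in `Rᶜ`, and the adversarial ones are those with index in `R`. -/
def IsContamination {N d : ℕ} (η : ℝ) (cln : Sample N d) (R : Finset (Fin N))
    (inp : Sample N d) : Prop :=
  R.card = ⌊η * (N : ℝ)⌋₊ ∧ ∀ i, i ∉ R → inp i = cln i

/-- The probability of an event under the uniform distribution over a finite type. -/
noncomputable def unifProb {Ω : Type} [Fintype Ω] (E : Ω → Prop) : ℝ :=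
  (Nat.card {ω : Ω // E ω} : ℝ) / (Fintype.card Ω : ℝ)

open Classical in
/-- The probability that `p x > τ` for a uniformly random example `x` of `smp` with index in `S`. -/
noncomputable def tailProb {N d : ℕ} (smp : Sample N d) (S : Finset (Fin N)) (p : CubePoly d)
    (τ : ℝ) : ℝ :=
  ((S.filter fun i => τ < evalAt p (smp i)).card : ℝ) / (S.card : ℝ)

/-- The coefficient bound `B = 3^k d^{k/2}` of the algorithm. -/
noncomputable def coefBound (d k : ℕ) : ℝ := 3 ^ k * (d : ℝ) ^ ((k : ℝ) / 2)

/-- The slack `Δ = ε / (2 B)` of the algorithm. -/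
noncomputable def slack (d k : ℕ) (ε : ℝ) : ℝ := ε / (2 * coefBound d k)

/-- The constraints of the linear program, for the reference sample `ref` and the input `inp`. -/
def IsFeasible {N d : ℕ} (k : ℕ) (ε : ℝ) (ref inp : Sample N d) (p : CubePoly d) : Prop :=
  DegLE k p ∧ coefNorm p ≤ coefBound d k ∧
    (∀ i, 0 ≤ evalAt p (ref i)) ∧ (∀ i, 0 ≤ evalAt p (inp i)) ∧
    1 / (N : ℝ) * ∑ i, evalAt p (ref i) ≤ ε / 4

/-- `p` is an optimal solution of the linear program with objective `∑ x ∈ S, p x`. -/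
def IsSolution {N d : ℕ} (k : ℕ) (ε : ℝ) (ref inp : Sample N d) (S : Finset (Fin N))
    (p : CubePoly d) : Prop :=
  IsFeasible k ε ref inp p ∧
    ∀ q, IsFeasible k ε ref inp q → ∑ i ∈ S, evalAt q (inp i) ≤ ∑ i ∈ S, evalAt p (inp i)

/-- The quantity `(1 / N) ∑ x ∈ S, p x`, which the algorithm compares with `ε`. -/
noncomputable def score {N d : ℕ} (inp : Sample N d) (S : Finset (Fin N)) (p : CubePoly d) : ℝ :=
  1 / (N : ℝ) * ∑ i ∈ S, evalAt p (inp i)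

/-- `τ` is the smallest `τ ≥ 0` with
`(|S| / N) Pr_{x ∼ S}[p x > τ] ≥ 2 Pr_{x ∼ ref}[p x > τ] + Δ`. -/
def IsThreshold {N d : ℕ} (k : ℕ) (ε : ℝ) (ref inp : Sample N d) (S : Finset (Fin N))
    (p : CubePoly d) (τ : ℝ) : Prop :=
  IsLeast {t : ℝ | 0 ≤ t ∧
    2 * tailProb ref Finset.univ p t + slack d k ε
      ≤ (S.card : ℝ) / (N : ℝ) * tailProb inp S p t} τ

open Classical in
/-- `Reaches k ε ref inp i S`: iteration `i` of the filtering algorithm can start with the set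
`S`, under some choice among the optimal solutions of the linear programs before it. -/
inductive Reaches {N d : ℕ} (k : ℕ) (ε : ℝ) (ref inp : Sample N d) :
    ℕ → Finset (Fin N) → Prop
  | start : Reaches k ε ref inp 0 Finset.univ
  | step {i : ℕ} {S : Finset (Fin N)} {p : CubePoly d} {τ : ℝ} :
      Reaches k ε ref inp i S → IsSolution k ε ref inp S p → ε < score inp S p →
      IsThreshold k ε ref inp S p τ →
      Reaches k ε ref inp (i + 1) (S \ S.filter fun j => τ < evalAt p (inp j))

/-- `T` is an output of the filtering algorithm, whose loop runs over `i = 0, 1, …, N`. -/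
def IsOutput {N d : ℕ} (k : ℕ) (ε : ℝ) (ref inp : Sample N d) (T : Finset (Fin N)) : Prop :=
  ∃ i ≤ N, Reaches k ε ref inp i T ∧ ∃ p, IsSolution k ε ref inp T p ∧ score inp T p ≤ ε

/-- Every run of the filtering algorithm produces an output, whichever optimal solutions it uses:
each linear program has an optimal solution, and an iteration that does not terminate finds its
threshold and is not the last iteration of the loop. -/
def AlwaysOutputs {N d : ℕ} (k : ℕ) (ε : ℝ) (ref inp : Sample N d) : Prop :=
  ∀ i S, Reaches k ε ref inp i S →
    (∃ p, IsSolution k ε ref inp S p) ∧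
    ∀ p, IsSolution k ε ref inp S p → ε < score inp S p →
      i < N ∧ ∃ τ, IsThreshold k ε ref inp S p τ

end OutlierRemoval

/-! Termination is a layer-cake argument. If no threshold in `[0, B]` were admissible, integrating
the failed inequalities would bound the score by `2 · ε/4 + Δ B ≤ ε`. A least threshold exists
because tail counts change only at finitely many values. Each step removes at least `N Δ > 0`
examples, so at most `N` steps occur (`Reaches.add_card_le`).

For claim 1, suppose that every inequality `0 < q` of degree at most `k` holds on the clean sample
at most `N Δ / 2` times more often than on the reference sample. The threshold rule then makes each
removed set at least twice as large as its clean part (`Reaches.card_clean_le`). The polynomials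
used depend on the samples, so this must hold for all `q` at once (`card_posCount_lt_le`). Swapping
clean and reference entries in pairs reduces it to random signs on a fixed pool of `2N` points,
where the positivity sets have VC dimension at most the number `V` of low-degree monomials. The
sample size is only of order `V / Δ²`, with no spare logarithm, so a plain union bound over traces
is too weak. Chaining over nets of geometrically decreasing radius, with Dudley's packing bound,
avoids the loss (`card_signs_unbalanced_le`).

For claim 2, a non-negative `p` of mean at most `ε/8` is shown to be feasible, so optimality at the
output bounds its sum (`IsOutput.sum_le`). Bonami's lemma and Hölder give `‖p‖₂ ≤ 3^k E p`; Parseval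
and Cauchy–Schwarz turn this into `coefNorm p ≤ B ε / 4`. If all non-constant low-degree monomials
have reference mean at most `1/(2B)` in absolute value, the reference mean of `p` is at most `ε/8 +
ε/8` (`isFeasible_of_balanced`). -/

namespace OutlierRemoval

open scoped symmDiff

/-! ### Sub-Gaussian tail bounds by counting -/

/-- Chernoff's bound for independent sub-Gaussian summands, in counting form. -/
theorem card_lt_sum_le {N : ℕ} {Y : Type*} [Fintype Y] (g : Fin N → Y → ℝ)
    (v : Fin N → ℝ) (w t : ℝ) (hw : 0 < w) (ht : 0 ≤ t) (hv : ∑ i, v i ≤ w)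
    (hg : ∀ i l, ∑ y, Real.exp (l * g i y) ≤ Fintype.card Y * Real.exp (l ^ 2 * v i / 2)) :
    (Nat.card {y : Fin N → Y // t < ∑ i, g i (y i)} : ℝ)
      ≤ (Fintype.card Y : ℝ) ^ N * Real.exp (-(t ^ 2 / (2 * w))) := by
  classical
  rw [Nat.card_eq_fintype_card, Fintype.card_subtype]
  -- This minimises the exponent `l² w / 2 - l t`.
  set l : ℝ := t / w with hl
  have hl0 : 0 ≤ l := by positivity
  have h1 : ((Finset.univ.filter fun y : Fin N → Y => t < ∑ i, g i (y i)).card : ℝ)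
      ≤ ∑ y : Fin N → Y, Real.exp (l * ∑ i, g i (y i) - l * t) := by
    rw [Finset.card_eq_sum_ones, Nat.cast_sum, Finset.sum_filter]
    refine Finset.sum_le_sum fun y _ => ?_
    split_ifs with h
    · rw [Nat.cast_one, Real.one_le_exp_iff, sub_nonneg]
      exact mul_le_mul_of_nonneg_left h.le hl0
    · positivity
  have h2 : ∑ y : Fin N → Y, Real.exp (l * ∑ i, g i (y i) - l * t)
      = Real.exp (-(l * t)) * ∏ i, ∑ y, Real.exp (l * g i y) := by
    rw [Finset.prod_univ_sum, Fintype.piFinset_univ, Finset.mul_sum]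
    refine Finset.sum_congr rfl fun y _ => ?_
    rw [← Real.exp_sum, ← Real.exp_add, Finset.mul_sum]
    congr 1
    ring
  have h3 : ∏ i, ∑ y, Real.exp (l * g i y)
      ≤ ∏ i : Fin N, ((Fintype.card Y : ℝ) * Real.exp (l ^ 2 * v i / 2)) :=
    Finset.prod_le_prod (fun i _ => by positivity) fun i _ => hg i l
  have h4 : ∏ i : Fin N, ((Fintype.card Y : ℝ) * Real.exp (l ^ 2 * v i / 2))
      = (Fintype.card Y : ℝ) ^ N * Real.exp (l ^ 2 * (∑ i, v i) / 2) := by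
    rw [Finset.prod_mul_distrib, ← Real.exp_sum, Finset.mul_sum, Finset.sum_div]
    simp
  have h5 : Real.exp (l ^ 2 * (∑ i, v i) / 2) ≤ Real.exp (l ^ 2 * w / 2) := by
    gcongr
  calc _ ≤ _ := h1
    _ = _ := h2
    _ ≤ Real.exp (-(l * t)) * ((Fintype.card Y : ℝ) ^ N * Real.exp (l ^ 2 * w / 2)) := by
      refine mul_le_mul_of_nonneg_left ?_ (by positivity)
      refine h3.trans (h4.trans_le ?_)
      exact mul_le_mul_of_nonneg_left h5 (by positivity)
    _ = (Fintype.card Y : ℝ) ^ N * (Real.exp (-(l * t)) * Real.exp (l ^ 2 * w / 2)) := by ring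
    _ = _ := by
      rw [← Real.exp_add]
      congr 2
      rw [hl]
      field_simp
      ring

/-- Hoeffding's inequality for sums of random signs. -/
theorem card_signs_lt_sum_le {N : ℕ} (a : Fin N → ℝ) (w t : ℝ) (hw : 0 < w) (ht : 0 ≤ t)
    (ha : ∑ i, a i ^ 2 ≤ w) :
    (Nat.card {σ : Fin N → ℤˣ // t < ∑ i, (((σ i : ℤˣ) : ℤ) : ℝ) * a i} : ℝ)
      ≤ (2 : ℝ) ^ N * Real.exp (-(t ^ 2 / (2 * w))) := by
  have h := card_lt_sum_le (Y := ℤˣ) (fun i s => ((s : ℤ) : ℝ) * a i) (fun i => a i ^ 2) w t hw ht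
    ha fun i l => by
      have hc := Real.cosh_le_exp_half_sq (l * a i)
      rw [Real.cosh_eq] at hc
      have : (Finset.univ : Finset ℤˣ) = {1, -1} := rfl
      rw [this, Finset.sum_pair (by decide)]
      simp only [Units.val_one, Int.cast_one, one_mul, Units.val_neg, Int.cast_neg, neg_mul,
        mul_neg, Fintype.card_units_int, Nat.cast_ofNat]
      rw [mul_pow] at hc
      linarith
  simpa using h

/-! ### Growth, packing and nets of set families -/

open Classical in
/-- The trace of a set of indices along a tuple of indices. -/
noncomputable def trace {ι : Type*} {s : ℕ} (z : Fin s → ι) (A : Finset ι) : Finset (Fin s) :=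
  Finset.univ.filter fun j => z j ∈ A

open Classical in
/-- The family has at most `t⁻ᵛ (1 + t)ˢ` traces along each `s`-tuple; families of
VC dimension `v` have this property. -/
def HasGrowth {ι : Type*} (V : ℕ) (𝒜 : Finset (Finset ι)) : Prop :=
  ∀ (s : ℕ) (z : Fin s → ι) (t : ℝ), 0 < t → t ≤ 1 →
    ((𝒜.image (trace z)).card : ℝ) ≤ (1 / t) ^ V * (1 + t) ^ s

theorem HasGrowth.mono {ι : Type*} {V : ℕ} {𝒜 ℬ : Finset (Finset ι)} (h : HasGrowth V 𝒜)
    (hs : ℬ ⊆ 𝒜) : HasGrowth V ℬ := by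
  classical
  intro s z t h0 h1
  refine le_trans ?_ (h s z t h0 h1)
  exact_mod_cast Finset.card_le_card (Finset.image_subset_image hs)

/-- A tuple of indices that is long enough tells the members of a separated family apart. -/
theorem exists_injOn_trace {ι : Type*} [Fintype ι] [DecidableEq ι] (𝒢 : Finset (Finset ι))
    (ρ : ℝ) (s : ℕ)
    (hsep : ∀ A ∈ 𝒢, ∀ B ∈ 𝒢, A ≠ B → ρ * Fintype.card ι < ((A ∆ B).card : ℝ))
    (hs : (𝒢.card : ℝ) ^ 2 * Real.exp (-(ρ * s)) < 1) (hι : 0 < Fintype.card ι) :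
    ∃ z : Fin s → ι, Set.InjOn (trace z) 𝒢 := by
  classical
  by_contra! hcon
  set n := Fintype.card ι with hn
  let P := (𝒢 ×ˢ 𝒢).filter fun p => p.1 ≠ p.2
  -- Probabilistic method: a tuple merges `A` and `B` only if all its entries avoid `A ∆ B`, a
  -- fraction below `exp (-ρ s)` of all tuples. A union bound over pairs leaves some tuple over.
  have hcov : (Finset.univ : Finset (Fin s → ι)) ⊆
      P.biUnion fun p => Fintype.piFinset fun _ : Fin s => (p.1 ∆ p.2)ᶜ := by
    intro z _
    have hz := hcon z
    simp only [Set.InjOn, not_forall] at hz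
    obtain ⟨A, hA, B, hB, hAB, hne⟩ := hz
    simp only [Finset.mem_biUnion]
    refine ⟨(A, B), by simp [P]; exact ⟨⟨hA, hB⟩, hne⟩, ?_⟩
    simp only [Fintype.mem_piFinset, Finset.mem_compl, Finset.mem_symmDiff]
    intro j
    have := Finset.ext_iff.1 hAB j
    simp only [trace, Finset.mem_filter, Finset.mem_univ, true_and] at this
    tauto
  have hcard := (Finset.card_le_card hcov).trans Finset.card_biUnion_le
  have hcard' : ((n : ℝ)) ^ s ≤ ∑ p ∈ P, (((p.1 ∆ p.2)ᶜ.card : ℝ)) ^ s := by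
    have : ((Finset.univ : Finset (Fin s → ι)).card : ℝ) ≤ _ := Nat.cast_le.2 hcard
    simpa [Fintype.card_piFinset] using this
  have hterm : ∀ p ∈ P, (((p.1 ∆ p.2)ᶜ.card : ℝ)) ^ s ≤ (n : ℝ) ^ s * Real.exp (-(ρ * s)) := by
    intro p hp
    simp only [P, Finset.mem_filter, Finset.mem_product] at hp
    have h1 := hsep _ hp.1.1 _ hp.1.2 hp.2
    have h2 : (((p.1 ∆ p.2)ᶜ.card : ℝ)) ≤ n * Real.exp (-ρ) := by
      have h3 : (((p.1 ∆ p.2)ᶜ.card : ℝ)) + ((p.1 ∆ p.2).card : ℝ) = n := by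
        rw [hn, ← Finset.card_compl_add_card (p.1 ∆ p.2)]
        push_cast
        rfl
      have h4 := Real.add_one_le_exp (-ρ)
      have hn' : (0 : ℝ) < n := by exact_mod_cast hι
      nlinarith
    calc _ ≤ (n * Real.exp (-ρ)) ^ s := by gcongr
      _ = _ := by
        rw [mul_pow, ← Real.exp_nat_mul]
        congr 2
        ring
  have hP : (P.card : ℝ) ≤ (𝒢.card : ℝ) ^ 2 := by
    have := Finset.card_filter_le (𝒢 ×ˢ 𝒢) fun p => p.1 ≠ p.2
    rw [Finset.card_product] at this
    rw [sq]
    exact_mod_cast this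
  have hfin := hcard'.trans (Finset.sum_le_card_nsmul _ _ _ hterm)
  rw [nsmul_eq_mul] at hfin
  have hpos : (0 : ℝ) < (n : ℝ) ^ s := by positivity
  have : (P.card : ℝ) * ((n : ℝ) ^ s * Real.exp (-(ρ * s))) ≤
      (n : ℝ) ^ s * ((𝒢.card : ℝ) ^ 2 * Real.exp (-(ρ * s))) := by
    have h := mul_le_mul_of_nonneg_right hP
      (by positivity : (0 : ℝ) ≤ (n : ℝ) ^ s * Real.exp (-(ρ * s)))
    linarith
  nlinarith

/-- Dudley's packing bound. -/
theorem log_card_le_of_separated {ι : Type*} [Fintype ι] [DecidableEq ι] {V : ℕ}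
    {𝒢 : Finset (Finset ι)} (h𝒢 : HasGrowth V 𝒢) {ρ : ℝ} (hρ : 0 < ρ) (hρ1 : ρ ≤ 1)
    (hsep : ∀ A ∈ 𝒢, ∀ B ∈ 𝒢, A ≠ B → ρ * Fintype.card ι < ((A ∆ B).card : ℝ))
    (hι : 0 < Fintype.card ι) (hne : 𝒢.Nonempty) :
    Real.log 𝒢.card ≤ 2 * V * Real.log (4 / ρ) + 1 := by
  classical
  set L := Real.log 𝒢.card with hL
  have hc : (1 : ℝ) ≤ 𝒢.card := by exact_mod_cast hne.card_pos
  have hL0 : 0 ≤ L := Real.log_nonneg hc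
  have hcard : (𝒢.card : ℝ) = Real.exp L := (Real.exp_log (by linarith)).symm
  -- The `+ 1` makes `2 L < ρ s` strict, as the union bound requires.
  let s := ⌈2 * L / ρ⌉₊ + 1
  have hs1 : 2 * L / ρ < s := by
    have := Nat.le_ceil (2 * L / ρ)
    simp only [s]
    push_cast
    linarith
  have hs2 : (s : ℝ) ≤ 2 * L / ρ + 2 := by
    have := Nat.ceil_lt_add_one (by positivity : 0 ≤ 2 * L / ρ)
    simp only [s]
    push_cast
    linarith
  obtain ⟨z, hz⟩ := exists_injOn_trace 𝒢 ρ s hsep (by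
    rw [hcard, ← Real.exp_nat_mul, ← Real.exp_add, Real.exp_lt_one_iff]
    rw [div_lt_iff₀ hρ] at hs1
    push_cast
    linarith) hι
  -- With `t = ρ / 4` the factor `(1 + t) ^ s` contributes at most `L / 2 + ρ / 2`, so half of `L`
  -- is absorbed on the left.
  have h := h𝒢 s z (ρ / 4) (by positivity) (by linarith)
  rw [Finset.card_image_of_injOn hz] at h
  have h1 := Real.log_le_log (by linarith) h
  rw [Real.log_mul (by positivity) (by positivity), Real.log_pow, Real.log_pow] at h1
  have h2 : Real.log (1 + ρ / 4) ≤ ρ / 4 := by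
    have := Real.log_le_sub_one_of_pos (by positivity : 0 < 1 + ρ / 4)
    linarith
  have h3 : (s : ℝ) * Real.log (1 + ρ / 4) ≤ (2 * L / ρ + 2) * (ρ / 4) :=
    mul_le_mul hs2 h2 (Real.log_nonneg (by linarith)) (by positivity)
  have h4 : (2 * L / ρ + 2) * (ρ / 4) = L / 2 + ρ / 2 := by
    field_simp
    ring
  rw [one_div_div] at h1
  linarith

/-- A maximal separated subfamily is a net. -/
theorem exists_separated_net {ι : Type*} [Fintype ι] [DecidableEq ι] (𝒜 : Finset (Finset ι))
    (h𝒜 : 𝒜.Nonempty) {r : ℝ} (hr : 0 ≤ r) :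
    ∃ 𝒢 ⊆ 𝒜, 𝒢.Nonempty ∧ (∀ A ∈ 𝒢, ∀ B ∈ 𝒢, A ≠ B → r < ((A ∆ B).card : ℝ)) ∧
      ∀ A ∈ 𝒜, ∃ B ∈ 𝒢, ((A ∆ B).card : ℝ) ≤ r := by
  classical
  let F := 𝒜.powerset.filter fun 𝒢 => ∀ A ∈ 𝒢, ∀ B ∈ 𝒢, A ≠ B → r < ((A ∆ B).card : ℝ)
  have hF : F.Nonempty := ⟨∅, by simp [F]⟩
  obtain ⟨𝒢, h𝒢, hmax⟩ := F.exists_max_image Finset.card hF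
  simp only [F, Finset.mem_filter, Finset.mem_powerset] at h𝒢 hmax
  have hnet : ∀ A ∈ 𝒜, ∃ B ∈ 𝒢, ((A ∆ B).card : ℝ) ≤ r := by
    intro A hA
    by_contra! hcon
    have hAG : A ∉ 𝒢 := fun h => by
      have := hcon A h
      simp only [symmDiff_self, Finset.bot_eq_empty, Finset.card_empty, Nat.cast_zero] at this
      linarith
    have := hmax (insert A 𝒢) ⟨Finset.insert_subset hA h𝒢.1, by
      intro B hB D hD hne
      rw [Finset.mem_insert] at hB hD
      rcases hB with rfl | hB <;> rcases hD with rfl | hD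
      · exact absurd rfl hne
      · exact hcon _ hD
      · rw [symmDiff_comm]
        exact hcon _ hB
      · exact h𝒢.2 _ hB _ hD hne⟩
    rw [Finset.card_insert_of_notMem hAG] at this
    omega
  obtain ⟨A, hA⟩ := h𝒜
  obtain ⟨B, hB, -⟩ := hnet A hA
  exact ⟨𝒢, h𝒢.1, ⟨B, hB⟩, h𝒢.2, hnet⟩

/-! ### Chaining for random signs -/

open Classical in
/-- How often pair `i` contributes to `A` with its left entry rather than with its right one. -/
noncomputable def pairDiff {N : ℕ} (A : Finset (Fin N ⊕ Fin N)) (i : Fin N) : ℝ :=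
  (if Sum.inl i ∈ A then 1 else 0) - (if Sum.inr i ∈ A then 1 else 0)

/-- This is the variance proxy of one link of a chain: close sets have signed sums with a small
difference. The 2 comes from `(u - v)² ≤ 2 u² + 2 v²`. -/
theorem sum_sq_pairDiff_sub_le {N : ℕ} (A B : Finset (Fin N ⊕ Fin N)) :
    ∑ i, (pairDiff A i - pairDiff B i) ^ 2 ≤ 2 * ((A ∆ B).card : ℝ) := by
  classical
  have h : ((A ∆ B).card : ℝ)
      = ∑ i, ((if Sum.inl i ∈ A ∆ B then (1 : ℝ) else 0) + if Sum.inr i ∈ A ∆ B then 1 else 0) := by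
    rw [Finset.sum_add_distrib, ← Fintype.sum_sum_type (fun x => if x ∈ A ∆ B then (1 : ℝ) else 0)]
    simp
  rw [h, Finset.mul_sum]
  refine Finset.sum_le_sum fun i _ => ?_
  simp only [pairDiff, Finset.mem_symmDiff]
  by_cases h1 : Sum.inl i ∈ A <;> by_cases h2 : Sum.inr i ∈ A <;> by_cases h3 : Sum.inl i ∈ B <;>
    by_cases h4 : Sum.inr i ∈ B <;> simp [h1, h2, h3, h4] <;> norm_num

/-- The arithmetic behind the union bound along a chain. -/
theorem chain_exponent_le {V M x : ℝ} {j : ℕ} (hV : 1 ≤ V) (hM : 1 ≤ M)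
    (hx : 1152 * V * M ≤ x) :
    (2 * V * Real.log (4 / (1 / 4) ^ (j + 1)) + 1) - x * (9 / 4) ^ j / 128
      ≤ -M + -((j : ℝ) + 1) * Real.log 2 := by
  have hlog : Real.log (4 / (1 / 4) ^ (j + 1)) = 2 * ((j : ℝ) + 2) * Real.log 2 := by
    have : (4 : ℝ) / (1 / 4) ^ (j + 1) = 2 ^ (2 * (j + 2)) := by
      rw [pow_mul, one_div, inv_pow, div_inv_eq_mul]
      norm_num
      ring
    rw [this, Real.log_pow]
    push_cast
    ring
  have hl2 : Real.log 2 ≤ 0.7 := by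
    have := Real.log_two_lt_d9
    linarith
  have hl0 : 0 ≤ Real.log 2 := Real.log_nonneg (by norm_num)
  have hb : (1 : ℝ) + (j : ℝ) * (5 / 4) ≤ (9 / 4) ^ j := by
    have := one_add_mul_le_pow (by norm_num : (-2 : ℝ) ≤ 5 / 4) j
    norm_num at this ⊢
    exact this
  have hj : (0 : ℝ) ≤ j := j.cast_nonneg
  have hVM : 1 ≤ V * M := by nlinarith
  have hx0 : 0 ≤ x := by nlinarith
  -- Here `9 = 1152 / 128`. Of these 9 units of `V M (j + 1)`, entropy takes 5.6, and `(j + 1) log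
  -- 2`, `M` and the constant 1 take at most one each.
  have h1 : 9 * (V * M) * (j + 1) ≤ x * (9 / 4) ^ j / 128 := by
    have : (1152 * V * M) * (j + 1) ≤ x * (9 / 4) ^ j :=
      mul_le_mul hx (by linarith) (by positivity) hx0
    linarith
  have h2 : 2 * V * (2 * ((j : ℝ) + 2) * Real.log 2) ≤ 5.6 * (V * M) * (j + 1) := by
    have a : 2 * ((j : ℝ) + 2) * Real.log 2 ≤ 2.8 * (j + 1) := by nlinarith
    have b : V ≤ V * M := by nlinarith
    have c : 2 * V * (2 * ((j : ℝ) + 2) * Real.log 2) ≤ 2 * V * (2.8 * (j + 1)) := by gcongr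
    have e : V * (j + 1) ≤ (V * M) * (j + 1) := by gcongr
    linarith
  have h3 : ((j : ℝ) + 1) * Real.log 2 ≤ (V * M) * (j + 1) := by nlinarith
  have h4 : M ≤ (V * M) * (j + 1) := by
    have : M ≤ V * M := by nlinarith
    nlinarith
  have h5 : 1 ≤ (V * M) * (j + 1) := by nlinarith
  rw [hlog]
  linarith

/-- Chaining: with few exceptions, a choice of signs balances all members of a family of
VC dimension `V` at once, without a logarithmic loss. -/
theorem card_signs_unbalanced_le {N V : ℕ} {𝒜 : Finset (Finset (Fin N ⊕ Fin N))}
    (h𝒜 : HasGrowth V 𝒜) (h0 : ∅ ∈ 𝒜) (hV : 1 ≤ V) {α M : ℝ} (hα : 0 ≤ α) (hM : 1 ≤ M)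
    (hN : 1152 * V * M ≤ N * α ^ 2) :
    (Nat.card {σ : Fin N → ℤˣ //
        ∃ A ∈ 𝒜, N * α < ∑ i, (((σ i : ℤˣ) : ℤ) : ℝ) * pairDiff A i} : ℝ)
      ≤ 2 ^ N * Real.exp (-M) := by
  classical
  have hV' : (1 : ℝ) ≤ V := by exact_mod_cast hV
  have hNpos : (0 : ℝ) < N := by
    have : (1 : ℝ) ≤ V * M := by nlinarith
    rcases Nat.eq_zero_or_pos N with rfl | h
    · simp only [Nat.cast_zero, zero_mul] at hN
      nlinarith
    · exact_mod_cast h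
  have hιcard : (Fintype.card (Fin N ⊕ Fin N) : ℝ) = 2 * N := by simp [two_mul]
  have hnet := fun j : ℕ => exists_separated_net 𝒜 ⟨∅, h0⟩
    (by positivity : (0 : ℝ) ≤ (1 / 4) ^ j * Fintype.card (Fin N ⊕ Fin N))
  choose G₀ hG₀ hGne hGsep hGnet using hnet
  -- All chains start at `∅`, whose signed sum is 0; at radius `2N` it is a net by itself.
  let G : ℕ → Finset (Finset (Fin N ⊕ Fin N)) := fun j => if j = 0 then {∅} else G₀ j
  have hπ : ∀ j A, A ∈ 𝒜 → ∃ B ∈ G j,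
      ((A ∆ B).card : ℝ) ≤ (1 / 4) ^ j * Fintype.card (Fin N ⊕ Fin N) := by
    intro j A hA
    rcases Nat.eq_zero_or_pos j with rfl | hj
    · refine ⟨∅, by simp [G], ?_⟩
      rw [pow_zero, one_mul]
      exact_mod_cast Finset.card_le_univ _
    · obtain ⟨B, hB, h⟩ := hGnet j A hA
      exact ⟨B, by simpa [G, hj.ne'] using hB, h⟩
  choose! π hπG hπd using hπ
  -- The allowances add up to at most `N α`. They shrink more slowly than the standard deviations,
  -- which scale as `2⁻ʲ`, so the exponents grow as `(9/4)^j` and beat the linearly growing entropy.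
  let t : ℕ → ℝ := fun j => N * α / 4 * (3 / 4) ^ j
  -- At a radius below 1 the net contains every member of the family, so chains end exactly at their
  -- target.
  obtain ⟨J, hJ⟩ : ∃ J : ℕ, (1 / 4 : ℝ) ^ J * Fintype.card (Fin N ⊕ Fin N) < 1 := by
    obtain ⟨J, hJ⟩ := exists_pow_lt_of_lt_one
      (by positivity : (0 : ℝ) < 1 / (2 * N)) (by norm_num : (1 / 4 : ℝ) < 1)
    refine ⟨J, ?_⟩
    rwa [hιcard, ← lt_div_iff₀ (by positivity)]
  let D : (Fin N → ℤˣ) → Finset (Fin N ⊕ Fin N) → ℝ := fun σ A =>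
    ∑ i, (((σ i : ℤˣ) : ℤ) : ℝ) * pairDiff A i
  have hchain : ∀ σ : Fin N → ℤˣ,
      (∀ j < J, ∀ A ∈ G₀ (j + 1), D σ A - D σ (π j A) ≤ t j) →
      ∀ j ≤ J, ∀ A ∈ G j, D σ A ≤ ∑ l ∈ Finset.range j, t l := by
    intro σ hσ j
    induction j with
    | zero =>
      intro _ A hA
      have : A = ∅ := by simpa [G] using hA
      subst this
      simp [D, pairDiff]
    | succ j ih =>
      intro hj A hA
      have hA' : A ∈ G₀ (j + 1) := by simpa [G] using hA
      have h1 := ih (by omega) (π j A) (hπG j A (hG₀ _ hA'))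
      have h2 := hσ j (by omega) A hA'
      rw [Finset.sum_range_succ]
      linarith
  have hsum : ∑ l ∈ Finset.range J, t l ≤ N * α := by
    simp only [t]
    rw [← Finset.mul_sum, geom_sum_eq (by norm_num)]
    have : (0 : ℝ) ≤ (3 / 4) ^ J := by positivity
    have hNα : 0 ≤ N * α := by positivity
    have e : (N : ℝ) * α / 4 * (((3 / 4) ^ J - 1) / (3 / 4 - 1)) = N * α * (1 - (3 / 4) ^ J) := by
      ring
    rw [e]
    nlinarith
  let bad : ℕ → Finset (Fin N ⊕ Fin N) → Finset (Fin N → ℤˣ) := fun j A =>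
    Finset.univ.filter fun σ => t j < D σ A - D σ (π j A)
  have hsub : (Finset.univ.filter fun σ : Fin N → ℤˣ => ∃ A ∈ 𝒜, N * α < D σ A) ⊆
      (Finset.range J).biUnion fun j => (G₀ (j + 1)).biUnion fun A => bad j A := by
    intro σ hσ
    simp only [Finset.mem_filter, Finset.mem_univ, true_and] at hσ
    obtain ⟨A, hA, hlt⟩ := hσ
    by_contra hcon
    simp only [Finset.mem_biUnion, Finset.mem_range, bad, Finset.mem_filter, Finset.mem_univ,
      true_and, not_exists, not_and, not_lt] at hcon
    have hAG : A ∈ G J := by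
      have h := (hπd J A hA).trans_lt hJ
      have h' : (A ∆ π J A).card = 0 := by
        have : (A ∆ π J A).card < 1 := by exact_mod_cast h
        omega
      rw [Finset.card_eq_zero, ← Finset.bot_eq_empty, symmDiff_eq_bot] at h'
      rw [h']
      exact hπG J A hA
    have := hchain σ hcon J le_rfl A hAG
    linarith
  have hbad : ∀ j, ∀ A ∈ G₀ (j + 1), ((bad j A).card : ℝ)
      ≤ 2 ^ N * Real.exp (-(N * α ^ 2 * (9 / 4) ^ j / 128)) := by
    intro j A hA
    have h := card_signs_lt_sum_le (fun i => pairDiff A i - pairDiff (π j A) i)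
      (4 * N * (1 / 4) ^ j) (t j) (by positivity) (by positivity) (by
        refine (sum_sq_pairDiff_sub_le A (π j A)).trans ?_
        have := hπd j A (hG₀ _ hA)
        rw [hιcard] at this
        linarith)
    rw [Nat.card_eq_fintype_card, Fintype.card_subtype] at h
    have e1 : (t j) ^ 2 / (2 * (4 * N * (1 / 4) ^ j)) = N * α ^ 2 * (9 / 4) ^ j / 128 := by
      have e2 : ((3 / 4 : ℝ) ^ j) ^ 2 = (9 / 4) ^ j * (1 / 4) ^ j := by
        rw [← pow_mul, mul_comm j 2, pow_mul, ← mul_pow]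
        norm_num
      simp only [t]
      rw [mul_pow, e2]
      have : (0 : ℝ) < (1 / 4) ^ j := by positivity
      field_simp
      ring
    rw [e1] at h
    refine le_trans (le_of_eq ?_) h
    congr 2
    ext σ
    simp only [bad, D, Finset.mem_filter, Finset.mem_univ, true_and, mul_sub,
      Finset.sum_sub_distrib]
  have hGc : ∀ j, ((G₀ (j + 1)).card : ℝ)
      ≤ Real.exp (2 * V * Real.log (4 / (1 / 4) ^ (j + 1)) + 1) := by
    intro j
    have h := log_card_le_of_separated (h𝒜.mono (hG₀ (j + 1)))
      (by positivity : (0 : ℝ) < (1 / 4) ^ (j + 1)) (pow_le_one₀ (by norm_num) (by norm_num))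
      (hGsep (j + 1)) (by
        have : (0 : ℝ) < Fintype.card (Fin N ⊕ Fin N) := by rw [hιcard]; positivity
        exact_mod_cast this) (hGne _)
    rwa [Real.log_le_iff_le_exp (by exact_mod_cast (hGne (j + 1)).card_pos)] at h
  -- The geometric weights make the failures of all levels sum to at most `exp (-M)`.
  have hlevel : ∀ j, ((((G₀ (j + 1)).biUnion fun A => bad j A).card : ℕ) : ℝ)
      ≤ 2 ^ N * Real.exp (-M) * (1 / 2) ^ (j + 1) := by
    intro j
    have h1 : ((((G₀ (j + 1)).biUnion fun A => bad j A).card : ℕ) : ℝ)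
        ≤ ∑ A ∈ G₀ (j + 1), ((bad j A).card : ℝ) := by
      exact_mod_cast Finset.card_biUnion_le
    refine (h1.trans (Finset.sum_le_card_nsmul _ _ _ (hbad j))).trans ?_
    rw [nsmul_eq_mul]
    have e : (1 / 2 : ℝ) ^ (j + 1) = Real.exp (-((j : ℝ) + 1) * Real.log 2) := by
      rw [mul_comm, Real.exp_mul, Real.exp_log (by norm_num), Real.rpow_neg (by norm_num),
        one_div, inv_pow]
      congr 1
      exact_mod_cast (Real.rpow_natCast 2 (j + 1)).symm
    rw [e, mul_assoc ((2 : ℝ) ^ N), ← Real.exp_add]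
    calc _ ≤ Real.exp (2 * V * Real.log (4 / (1 / 4) ^ (j + 1)) + 1) *
          (2 ^ N * Real.exp (-(N * α ^ 2 * (9 / 4) ^ j / 128))) := by gcongr; exact hGc j
      _ = 2 ^ N * Real.exp ((2 * V * Real.log (4 / (1 / 4) ^ (j + 1)) + 1)
            - N * α ^ 2 * (9 / 4) ^ j / 128) := by
        rw [mul_left_comm, ← Real.exp_add, ← sub_eq_add_neg]
      _ ≤ _ := by
        gcongr
        exact chain_exponent_le hV' hM hN
  rw [Nat.card_eq_fintype_card, Fintype.card_subtype]
  have h1 : ((Finset.univ.filter fun σ : Fin N → ℤˣ => ∃ A ∈ 𝒜, N * α < D σ A).card : ℝ)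
      ≤ ∑ j ∈ Finset.range J, 2 ^ N * Real.exp (-M) * (1 / 2) ^ (j + 1) := by
    refine le_trans ?_ (Finset.sum_le_sum fun j _ => hlevel j)
    exact_mod_cast (Finset.card_le_card hsub).trans Finset.card_biUnion_le
  refine h1.trans ?_
  have h2 : ∑ j ∈ Finset.range J, (1 / 2 : ℝ) ^ (j + 1) ≤ 1 := by
    simp only [pow_succ]
    rw [← Finset.sum_mul]
    rw [geom_sum_eq (by norm_num)]
    have : (0 : ℝ) ≤ (1 / 2) ^ J := by positivity
    have e : ((1 / 2 : ℝ) ^ J - 1) / (1 / 2 - 1) * (1 / 2) = 1 - (1 / 2) ^ J := by ring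
    rw [e]
    linarith
  rw [← Finset.mul_sum]
  exact mul_le_of_le_one_right (by positivity) h2

/-! ### Low-degree monomials and the VC dimension of polynomial inequalities -/

/-- The monomials of degree at most `k`. -/
def lowMonomials (d k : ℕ) : Finset (Finset (Fin d)) := Finset.univ.filter fun I => I.card ≤ k

theorem mem_lowMonomials {d k : ℕ} {I : Finset (Fin d)} : I ∈ lowMonomials d k ↔ I.card ≤ k := by
  simp [lowMonomials]

/-- The monomial `x^I`. -/
noncomputable def monomialAt {d : ℕ} (I : Finset (Fin d)) (x : Cube d) : ℝ :=
  ∏ i ∈ I, (((x i : ℤˣ) : ℤ) : ℝ)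

theorem evalAt_eq_sum {d : ℕ} (p : CubePoly d) (x : Cube d) :
    evalAt p x = ∑ I, p I * monomialAt I x := rfl

theorem evalAt_eq_sum_lowMonomials {d k : ℕ} {p : CubePoly d} (hp : DegLE k p) (x : Cube d) :
    evalAt p x = ∑ I ∈ lowMonomials d k, p I * monomialAt I x := by
  rw [evalAt_eq_sum]
  refine (Finset.sum_subset (Finset.subset_univ _) fun I _ hI => ?_).symm
  rw [mem_lowMonomials, not_le] at hI
  rw [hp I hI, zero_mul]

theorem one_le_card_lowMonomials (d k : ℕ) : 1 ≤ (lowMonomials d k).card :=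
  Finset.card_pos.2 ⟨∅, by simp [mem_lowMonomials]⟩

/-- A non-empty set of at most `k` coordinates is the range of a map from `Fin k`: enumerate it and
pad with one of its elements. -/
theorem card_nonempty_lowMonomials_le (d k : ℕ) : ((lowMonomials d k).erase ∅).card ≤ d ^ k := by
  classical
  have h : (lowMonomials d k).erase ∅
      ⊆ (Finset.univ : Finset (Fin k → Fin d)).image fun f => Finset.univ.image f := by
    intro I hI
    rw [Finset.mem_erase, mem_lowMonomials, ← Finset.nonempty_iff_ne_empty] at hI
    obtain ⟨⟨a, ha⟩, hk⟩ := hI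
    rw [Finset.mem_image]
    refine ⟨fun j => if h : (j : ℕ) < I.card then I.equivFin.symm ⟨j, h⟩ else a,
      Finset.mem_univ _, ?_⟩
    ext i
    simp only [Finset.mem_image, Finset.mem_univ, true_and]
    constructor
    · rintro ⟨j, rfl⟩
      split_ifs with h
      · exact (I.equivFin.symm ⟨j, h⟩).2
      · exact ha
    · intro hi
      refine ⟨⟨I.equivFin ⟨i, hi⟩, (I.equivFin ⟨i, hi⟩).2.trans_le hk⟩, ?_⟩
      simp
  refine (Finset.card_le_card h).trans (Finset.card_image_le.trans ?_)
  simp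

/-- The hypothesis excludes `d = 0 < k`, where `d ^ k = 0` although the empty monomial remains. -/
theorem card_lowMonomials_le {d k : ℕ} (h : 0 < d ∨ k = 0) :
    ((lowMonomials d k).card : ℝ) ≤ 2 * (d : ℝ) ^ k := by
  have h1 := card_nonempty_lowMonomials_le d k
  rw [Finset.card_erase_of_mem (by simp [mem_lowMonomials])] at h1
  have h2 : 1 ≤ d ^ k := by
    rcases h with h | rfl
    · exact Nat.one_le_pow _ _ h
    · simp
  have h3 : (lowMonomials d k).card ≤ 2 * d ^ k := by omega
  exact_mod_cast h3

open Classical in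
/-- The subsets of a sample that are cut out by polynomial inequalities `0 < q`. -/
noncomputable def posSets {ι : Type*} [Fintype ι] {d : ℕ} (k : ℕ) (x : ι → Cube d) :
    Finset (Finset ι) :=
  Finset.univ.filter fun A => ∃ q : CubePoly d, DegLE k q ∧ ∀ i, i ∈ A ↔ 0 < evalAt q (x i)

theorem mem_posSets {ι : Type*} [Fintype ι] {d k : ℕ} {x : ι → Cube d} {A : Finset ι} :
    A ∈ posSets k x ↔ ∃ q : CubePoly d, DegLE k q ∧ ∀ i, i ∈ A ↔ 0 < evalAt q (x i) := by
  simp [posSets]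

/-- Positivity sets of polynomials of degree `k` shatter at most as many points as there are
monomials of degree `k`. -/
theorem card_le_of_shatters {ι : Type*} [Fintype ι] [DecidableEq ι] {d k : ℕ} {x : ι → Cube d}
    {S : Finset ι} (h : (posSets k x).Shatters S) : S.card ≤ (lowMonomials d k).card := by
  by_contra! hlt
  let f : (S → ℝ) →ₗ[ℝ] (lowMonomials d k → ℝ) :=
    { toFun := fun a I => ∑ i, a i * monomialAt I.1 (x i)
      map_add' := fun a b => by
        ext I
        simp [add_mul, Finset.sum_add_distrib]
      map_smul' := fun c a => by
        ext I
        simp [Finset.mul_sum, mul_assoc] }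
  -- With more points than monomials, some non-zero weights on the points annihilate every
  -- polynomial of degree at most `k`.
  have hker : LinearMap.ker f ≠ ⊥ := f.ker_ne_bot_of_finrank_lt (by simpa using hlt)
  obtain ⟨a, ha, hne⟩ := (Submodule.ne_bot_iff _).1 hker
  obtain ⟨b, hb, i₀, hi₀⟩ : ∃ b ∈ LinearMap.ker f, ∃ i, 0 < b i := by
    obtain ⟨i, hi⟩ := Function.ne_iff.1 hne
    rcases lt_or_gt_of_ne hi with hi | hi
    · exact ⟨-a, neg_mem ha, i, by simpa using hi⟩
    · exact ⟨a, ha, i, hi⟩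
  have horth : ∀ q : CubePoly d, DegLE k q → ∑ i, b i * evalAt q (x i) = 0 := by
    intro q hq
    have h1 : ∀ I ∈ lowMonomials d k, ∑ i, b i * monomialAt I (x i) = 0 := by
      intro I hI
      exact congrFun (LinearMap.mem_ker.1 hb) ⟨I, hI⟩
    simp only [evalAt_eq_sum_lowMonomials hq, Finset.mul_sum]
    rw [Finset.sum_comm]
    refine Finset.sum_eq_zero fun I hI => ?_
    rw [← mul_zero (q I), ← h1 I hI, Finset.mul_sum]
    exact Finset.sum_congr rfl fun i _ => by ring
  -- Shattering gives a polynomial that is positive exactly where the weights are, so its weighted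
  -- sum is positive and not 0.
  obtain ⟨A, hA, hSA⟩ := h (t := (Finset.univ.filter fun i : S => 0 < b i).map
    (Function.Embedding.subtype _)) (by
      intro i hi
      simp only [Finset.mem_map, Function.Embedding.subtype_apply] at hi
      obtain ⟨j, -, rfl⟩ := hi
      exact j.2)
  obtain ⟨q, hq, hqA⟩ := mem_posSets.1 hA
  have hpos : ∀ i : S, 0 < evalAt q (x i) ↔ 0 < b i := by
    intro i
    have := Finset.ext_iff.1 hSA i
    simpa [← hqA] using this
  have : 0 < ∑ i, b i * evalAt q (x i) := by
    refine Finset.sum_pos' (fun i _ => ?_) ⟨i₀, Finset.mem_univ _, ?_⟩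
    · rcases le_or_gt (b i) 0 with hi | hi
      · exact mul_nonneg_of_nonpos_of_nonpos hi
          (not_lt.1 fun hc => not_lt.2 hi ((hpos i).1 hc))
      · exact (mul_pos hi ((hpos i).2 hi)).le
    · exact mul_pos hi₀ ((hpos i₀).2 hi₀)
  exact this.ne' (horth q hq)

/-- Each counted set has `t ^ |S| ≥ t ^ m`, and the binomial theorem sums `t ^ |S|` over all sets to
`(1 + t) ^ s`. -/
theorem card_filter_card_le {s m : ℕ} {t : ℝ} (h0 : 0 < t) (h1 : t ≤ 1) :
    ((Finset.univ.filter fun S : Finset (Fin s) => S.card ≤ m).card : ℝ)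
      ≤ (1 / t) ^ m * (1 + t) ^ s := by
  have h := Fintype.sum_pow_mul_eq_add_pow (Fin s) t 1
  simp only [one_pow, mul_one, Fintype.card_fin] at h
  rw [add_comm 1 t, ← h, Finset.mul_sum, Finset.card_eq_sum_ones, Nat.cast_sum, Finset.sum_filter]
  refine Finset.sum_le_sum fun S _ => ?_
  split_ifs with hS
  · rw [Nat.cast_one, one_div, inv_pow, ← div_eq_inv_mul, one_le_div (by positivity)]
    exact pow_le_pow_of_le_one h0.le h1 hS
  · positivity

/-- Traces along `z` are positivity sets on the pulled-back points `x ∘ z`. By Pajor's form of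
Sauer–Shelah they are no more numerous than the sets they shatter, which are small. -/
theorem hasGrowth_posSets {ι : Type*} [Fintype ι] {d k : ℕ} (x : ι → Cube d) :
    HasGrowth (lowMonomials d k).card (posSets k x) := by
  classical
  intro s z t h0 h1
  refine le_trans ?_ (card_filter_card_le h0 h1)
  have hsub : (posSets k x).image (trace z) ⊆ posSets k (x ∘ z) := by
    intro A hA
    obtain ⟨B, hB, rfl⟩ := Finset.mem_image.1 hA
    obtain ⟨q, hq, hqB⟩ := mem_posSets.1 hB
    exact mem_posSets.2 ⟨q, hq, fun i => by simp [trace, hqB]⟩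
  have hsh : (posSets k (x ∘ z)).shatterer
      ⊆ Finset.univ.filter fun S : Finset (Fin s) => S.card ≤ (lowMonomials d k).card := by
    intro S hS
    rw [Finset.mem_shatterer] at hS
    simpa using card_le_of_shatters hS
  exact_mod_cast (Finset.card_le_card hsub).trans
    ((Finset.card_le_card_shatterer _).trans (Finset.card_le_card hsh))

/-! ### Symmetrisation and uniform convergence -/

theorem unifProb_mono {Ω : Type} [Fintype Ω] {E F : Ω → Prop} (h : ∀ ω, E ω → F ω) :
    unifProb E ≤ unifProb F := by
  classical
  unfold unifProb
  gcongr
  exact Nat.card_le_card_of_injective (fun ω : {ω // E ω} => (⟨ω.1, h _ ω.2⟩ : {ω // F ω}))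
    fun a b hab => Subtype.ext (by simpa using hab)

theorem one_sub_le_unifProb {Ω : Type} [Fintype Ω] [Nonempty Ω] {E : Ω → Prop} {δ : ℝ}
    (h : (Nat.card {ω // ¬ E ω} : ℝ) ≤ Fintype.card Ω * δ) : 1 - δ ≤ unifProb E := by
  classical
  have hpos : (0 : ℝ) < Fintype.card Ω := by exact_mod_cast Fintype.card_pos
  unfold unifProb
  rw [le_div_iff₀ hpos]
  have h1 : (Fintype.card {ω // E ω} : ℝ) + Fintype.card {ω // ¬ E ω} = Fintype.card Ω := by
    rw [Fintype.card_subtype_compl, Nat.cast_sub (Fintype.card_subtype_le _)]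
    ring
  rw [Nat.card_eq_fintype_card] at h ⊢
  linarith

open Classical in
/-- The number of examples at which the polynomial is positive. -/
noncomputable def posCount {N d : ℕ} (q : CubePoly d) (x : Sample N d) : ℝ :=
  ((Finset.univ.filter fun i => 0 < evalAt q (x i)).card : ℝ)

/-- Exchange the entries of a pair of samples at the indices of sign `-1`. -/
def swapBy {N d : ℕ} (σ : Fin N → ℤˣ) (ω : Sample N d × Sample N d) :
    Sample N d × Sample N d :=
  (fun i => if σ i = 1 then ω.1 i else ω.2 i, fun i => if σ i = 1 then ω.2 i else ω.1 i)

theorem swapBy_involutive {N d : ℕ} (σ : Fin N → ℤˣ) :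
    Function.Involutive (swapBy (d := d) σ) := by
  intro ω
  refine Prod.ext (funext fun i => ?_) (funext fun i => ?_) <;>
    by_cases h : σ i = 1 <;> simp [swapBy, h]

/-- Symmetrisation: a bound on the bad signs for each pair of samples bounds the bad pairs. -/
theorem card_le_of_swap {N d : ℕ} (E : Sample N d × Sample N d → Prop) (c : ℝ)
    (h : ∀ ω, (Nat.card {σ : Fin N → ℤˣ // E (swapBy σ ω)} : ℝ) ≤ 2 ^ N * c) :
    (Nat.card {ω // E ω} : ℝ) ≤ Fintype.card (Sample N d × Sample N d) * c := by
  classical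
  -- Each swap permutes the pairs of samples, so the count of bad pairs equals its average over all
  -- swaps.
  have h1 : ∀ σ : Fin N → ℤˣ,
      (Nat.card {ω // E ω} : ℝ) = ∑ ω, if E (swapBy σ ω) then (1 : ℝ) else 0 := by
    intro σ
    have e := Equiv.sum_comp (Function.Involutive.toPerm _ (swapBy_involutive (d := d) σ))
      (fun ω => if E ω then (1 : ℝ) else 0)
    simp only [Function.Involutive.coe_toPerm] at e
    refine Eq.trans ?_ e.symm
    rw [Nat.card_eq_fintype_card, Fintype.card_subtype]
    simp
  have h2 : (2 : ℝ) ^ N * (Nat.card {ω // E ω} : ℝ)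
      = ∑ ω, (Nat.card {σ : Fin N → ℤˣ // E (swapBy σ ω)} : ℝ) := by
    have : (2 : ℝ) ^ N * (Nat.card {ω // E ω} : ℝ)
        = ∑ σ : Fin N → ℤˣ, (Nat.card {ω // E ω} : ℝ) := by simp
    rw [this, Finset.sum_congr rfl fun σ _ => h1 σ, Finset.sum_comm]
    refine Finset.sum_congr rfl fun ω _ => ?_
    rw [Nat.card_eq_fintype_card, Fintype.card_subtype]
    simp
  have h3 : ∑ ω : Sample N d × Sample N d, (Nat.card {σ : Fin N → ℤˣ // E (swapBy σ ω)} : ℝ)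
      ≤ Fintype.card (Sample N d × Sample N d) * (2 ^ N * c) := by
    refine (Finset.sum_le_sum fun ω _ => h ω).trans ?_
    simp
  rw [← h2] at h3
  have h4 : (0 : ℝ) < 2 ^ N := by positivity
  refine le_of_mul_le_mul_left ?_ h4
  linarith

/-- Swapping pair `i` negates its contribution. The set `A` lives on the unswapped pool, so the
family is fixed before the signs are drawn. -/
theorem posCount_swapBy_sub {N d : ℕ} (q : CubePoly d) (σ : Fin N → ℤˣ)
    (ω : Sample N d × Sample N d) (A : Finset (Fin N ⊕ Fin N))
    (hA : ∀ i, i ∈ A ↔ 0 < evalAt q (Sum.elim ω.1 ω.2 i)) :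
    posCount q (swapBy σ ω).1 - posCount q (swapBy σ ω).2
      = ∑ i, (((σ i : ℤˣ) : ℤ) : ℝ) * pairDiff A i := by
  classical
  simp only [posCount, Finset.card_filter, Nat.cast_sum]
  rw [← Finset.sum_sub_distrib]
  refine Finset.sum_congr rfl fun i _ => ?_
  simp only [pairDiff, hA, Sum.elim_inl, Sum.elim_inr, swapBy]
  rcases Int.units_eq_one_or (σ i) with h | h <;> simp [h]

/-- Uniform convergence for polynomial inequalities, between two independent samples. -/
theorem card_posCount_lt_le {N d k : ℕ} {α M : ℝ} (hα : 0 ≤ α) (hM : 1 ≤ M)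
    (hN : 1152 * (lowMonomials d k).card * M ≤ N * α ^ 2) :
    (Nat.card {ω : Sample N d × Sample N d // ¬ ∀ q : CubePoly d, DegLE k q →
        posCount q ω.1 ≤ posCount q ω.2 + N * α} : ℝ)
      ≤ Fintype.card (Sample N d × Sample N d) * Real.exp (-M) := by
  classical
  refine card_le_of_swap _ _ fun ω => ?_
  have h := card_signs_unbalanced_le (N := N) (hasGrowth_posSets (k := k) (Sum.elim ω.1 ω.2))
    (mem_posSets.2 ⟨0, fun I _ => rfl, fun i => by simp [evalAt]⟩)
    (one_le_card_lowMonomials d k) hα hM hN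
  refine le_trans ?_ h
  refine Nat.cast_le.2 (Nat.card_le_card_of_injective (fun σ : {σ : Fin N → ℤˣ // _} =>
    (⟨σ.1, ?_⟩ : {σ : Fin N → ℤˣ // ∃ A ∈ posSets k (Sum.elim ω.1 ω.2),
      N * α < ∑ i, (((σ i : ℤˣ) : ℤ) : ℝ) * pairDiff A i}))
    fun a b hab => Subtype.ext (by simpa using hab))
  have hσ := σ.2
  push Not at hσ
  obtain ⟨q, hq, hlt⟩ := hσ
  have hA : ∀ i, i ∈ (Finset.univ.filter fun i => 0 < evalAt q (Sum.elim ω.1 ω.2 i)) ↔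
      0 < evalAt q (Sum.elim ω.1 ω.2 i) := by simp
  refine ⟨_, mem_posSets.2 ⟨q, hq, hA⟩, ?_⟩
  rw [← posCount_swapBy_sub q σ.1 ω _ hA]
  linarith

/-! ### Fourier analysis and hypercontractivity on the cube -/

/-- Change the sign of one coordinate. -/
def flipAt {d : ℕ} (a : Fin d) (x : Cube d) : Cube d := Function.update x a (-x a)

theorem flipAt_involutive {d : ℕ} (a : Fin d) : Function.Involutive (flipAt a) := by
  intro x
  simp [flipAt]

theorem sum_flipAt {d : ℕ} (a : Fin d) (f : Cube d → ℝ) : ∑ x, f (flipAt a x) = ∑ x, f x :=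
  Equiv.sum_comp (flipAt_involutive a).toPerm f

theorem monomialAt_flipAt {d : ℕ} (a : Fin d) (I : Finset (Fin d)) (x : Cube d) :
    monomialAt I (flipAt a x) = (if a ∈ I then -1 else 1) * monomialAt I x := by
  unfold monomialAt
  split_ifs with h
  · rw [← Finset.mul_prod_erase _ _ h, ← Finset.mul_prod_erase _ _ h]
    have : ∏ i ∈ I.erase a, (((flipAt a x i : ℤˣ) : ℤ) : ℝ)
        = ∏ i ∈ I.erase a, (((x i : ℤˣ) : ℤ) : ℝ) :=
      Finset.prod_congr rfl fun i hi => by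
        rw [flipAt, Function.update_of_ne (Finset.ne_of_mem_erase hi)]
    rw [this, flipAt, Function.update_self]
    push_cast
    ring
  · rw [one_mul]
    refine Finset.prod_congr rfl fun i hi => ?_
    rw [flipAt, Function.update_of_ne (ne_of_mem_of_not_mem hi h)]

theorem coord_sq {d : ℕ} (x : Cube d) (a : Fin d) : (((x a : ℤˣ) : ℤ) : ℝ) ^ 2 = 1 := by
  rcases Int.units_eq_one_or (x a) with h | h <;> simp [h]

theorem monomialAt_sq {d : ℕ} (I : Finset (Fin d)) (x : Cube d) : monomialAt I x ^ 2 = 1 := by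
  unfold monomialAt
  rw [← Finset.prod_pow]
  exact Finset.prod_eq_one fun i _ => coord_sq x i

theorem abs_monomialAt {d : ℕ} (I : Finset (Fin d)) (x : Cube d) : |monomialAt I x| = 1 := by
  rw [← sq_eq_sq₀ (abs_nonneg _) zero_le_one, sq_abs, monomialAt_sq, one_pow]

theorem sum_monomialAt {d : ℕ} {I : Finset (Fin d)} (hI : I ≠ ∅) : ∑ x, monomialAt I x = 0 := by
  obtain ⟨a, ha⟩ := Finset.nonempty_iff_ne_empty.2 hI
  have h := sum_flipAt a (monomialAt I)
  simp only [monomialAt_flipAt, ha, if_true, ← Finset.mul_sum] at h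
  linarith

/-- Flipping a coordinate that lies in exactly one of `I` and `J` negates the product and permutes
the cube. -/
theorem sum_monomialAt_mul {d : ℕ} {I J : Finset (Fin d)} (h : I ≠ J) :
    ∑ x, monomialAt I x * monomialAt J x = 0 := by
  obtain ⟨a, ha⟩ : ∃ a, ¬ (a ∈ I ↔ a ∈ J) := by
    by_contra! hc
    exact h (Finset.ext hc)
  have h := sum_flipAt a (fun x => monomialAt I x * monomialAt J x)
  simp only [monomialAt_flipAt] at h
  have e : ∀ x : Cube d, (if a ∈ I then (-1 : ℝ) else 1) * monomialAt I x
      * ((if a ∈ J then (-1 : ℝ) else 1) * monomialAt J x)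
      = -1 * (monomialAt I x * monomialAt J x) := by
    intro x
    by_cases h1 : a ∈ I <;> by_cases h2 : a ∈ J <;> simp_all
  rw [Finset.sum_congr rfl fun x _ => e x, ← Finset.mul_sum] at h
  linarith

/-- Parseval's identity. -/
theorem sum_sq_evalAt {d : ℕ} (p : CubePoly d) :
    ∑ x, evalAt p x ^ 2 = Fintype.card (Cube d) * ∑ I, p I ^ 2 := by
  have h : ∀ x : Cube d, evalAt p x ^ 2
      = ∑ I, ∑ J, p I * p J * (monomialAt I x * monomialAt J x) := by
    intro x
    rw [evalAt_eq_sum, sq, Finset.sum_mul_sum]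
    exact Finset.sum_congr rfl fun I _ => Finset.sum_congr rfl fun J _ => by ring
  rw [Finset.sum_congr rfl fun x _ => h x, Finset.sum_comm, Finset.mul_sum]
  refine Finset.sum_congr rfl fun I _ => ?_
  rw [Finset.sum_comm, Finset.sum_eq_single I]
  · rw [← Finset.mul_sum]
    simp only [← sq, monomialAt_sq]
    simp only [Finset.sum_const, Finset.card_univ, nsmul_eq_mul, mul_one]
    ring
  · intro J _ hJ
    rw [← Finset.mul_sum, sum_monomialAt_mul hJ.symm, mul_zero]
  · simp

theorem sum_evalAt {d : ℕ} (p : CubePoly d) :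
    ∑ x, evalAt p x = Fintype.card (Cube d) * p ∅ := by
  simp only [evalAt_eq_sum]
  rw [Finset.sum_comm, Finset.sum_eq_single ∅]
  · simp [monomialAt]
  · intro I _ hI
    rw [← Finset.mul_sum, sum_monomialAt hI, mul_zero]
  · simp

theorem card_cube_pos (d : ℕ) : (0 : ℝ) < Fintype.card (Cube d) := by
  exact_mod_cast Fintype.card_pos

theorem unifMean_eq {d : ℕ} (p : CubePoly d) : unifMean p = p ∅ := by
  rw [unifMean, sum_evalAt, mul_div_cancel_left₀ _ (card_cube_pos d).ne']

/-- Split a polynomial at a coordinate: `p = q + x_a r`. -/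
theorem evalAt_split {d : ℕ} (p : CubePoly d) (a : Fin d) (x : Cube d) :
    evalAt p x = evalAt (fun I => if a ∈ I then 0 else p I) x
      + (((x a : ℤˣ) : ℤ) : ℝ) * evalAt (fun I => if a ∈ I then 0 else p (insert a I)) x := by
  have hu : ∀ f : Finset (Fin d) → ℝ, ∑ I, f I
      = ∑ I ∈ (Finset.univ.erase a).powerset, f I
        + ∑ I ∈ (Finset.univ.erase a).powerset, f (insert a I) := by
    intro f
    rw [← Finset.sum_powerset_insert (Finset.notMem_erase a _),
      Finset.insert_erase (Finset.mem_univ a), Finset.powerset_univ]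
  have hm : ∀ I ∈ (Finset.univ.erase a).powerset, a ∉ I := by
    intro I hI ha
    exact Finset.notMem_erase a _ (Finset.mem_powerset.1 hI ha)
  simp only [evalAt_eq_sum]
  rw [hu, hu (fun I => (if a ∈ I then 0 else p I) * monomialAt I x),
    hu (fun I => (if a ∈ I then 0 else p (insert a I)) * monomialAt I x)]
  simp only [Finset.mem_insert_self, if_true, zero_mul, Finset.sum_const_zero, add_zero]
  rw [Finset.mul_sum]
  congr 1
  · exact Finset.sum_congr rfl fun I hI => by rw [if_neg (hm I hI)]
  · refine Finset.sum_congr rfl fun I hI => ?_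
    rw [if_neg (hm I hI), monomialAt, Finset.prod_insert (hm I hI), monomialAt]
    ring

theorem evalAt_flipAt_of_support {d : ℕ} (p : CubePoly d) (a : Fin d)
    (hp : ∀ I, a ∈ I → p I = 0) (x : Cube d) : evalAt p (flipAt a x) = evalAt p x := by
  simp only [evalAt_eq_sum, monomialAt_flipAt]
  refine Finset.sum_congr rfl fun I _ => ?_
  by_cases h : a ∈ I <;> simp [h, hp]

/-- Bonami's lemma: a polynomial of low degree has a small fourth moment. -/
theorem sum_pow_four_le {d : ℕ} (S : Finset (Fin d)) : ∀ (k : ℕ) (p : CubePoly d),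
    (∀ I, p I ≠ 0 → I ⊆ S ∧ I.card ≤ k) →
    Fintype.card (Cube d) * ∑ x, evalAt p x ^ 4 ≤ 9 ^ k * (∑ x, evalAt p x ^ 2) ^ 2 := by
  classical
  induction S using Finset.induction_on with
  | empty =>
    intro k p hp
    have h : ∀ x, evalAt p x = p ∅ := by
      intro x
      rw [evalAt_eq_sum, Finset.sum_eq_single ∅]
      · simp [monomialAt]
      · intro I _ hI
        have : p I = 0 := by
          by_contra hc
          exact hI (Finset.subset_empty.1 (hp I hc).1)
        rw [this, zero_mul]
      · simp
    simp only [h, Finset.sum_const, Finset.card_univ, nsmul_eq_mul]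
    have h9 : (1 : ℝ) ≤ 9 ^ k := one_le_pow₀ (by norm_num)
    have : 0 ≤ (Fintype.card (Cube d) * p ∅ ^ 2) ^ 2 := by positivity
    calc _ = 1 * (Fintype.card (Cube d) * p ∅ ^ 2) ^ 2 := by ring
      _ ≤ _ := by gcongr
  | insert a S ha ih =>
    intro k p hp
    rcases k with _ | k
    · refine ih 0 p fun I hI => ⟨?_, (hp I hI).2⟩
      have : I = ∅ := by simpa using (hp I hI).2
      simp [this]
    set q : CubePoly d := fun I => if a ∈ I then 0 else p I with hq
    set r : CubePoly d := fun I => if a ∈ I then 0 else p (insert a I) with hr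
    have hqs := ih (k + 1) q fun I hI => by
      have haI : a ∉ I := fun h => hI (by simp [hq, h])
      have := hp I (by simpa [hq, haI] using hI)
      exact ⟨(Finset.subset_insert_iff_of_notMem haI).1 this.1, this.2⟩
    have hrs := ih k r fun I hI => by
      have haI : a ∉ I := fun h => hI (by simp [hr, h])
      have := hp (insert a I) (by simpa [hr, haI] using hI)
      rw [Finset.card_insert_of_notMem haI] at this
      refine ⟨fun i hi => ?_, by omega⟩
      have h2 := this.1 (Finset.mem_insert_of_mem hi)
      rw [Finset.mem_insert] at h2
      exact h2.resolve_left fun e => haI (e ▸ hi)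
    have hsplit : ∀ x, evalAt p x = evalAt q x + (((x a : ℤˣ) : ℤ) : ℝ) * evalAt r x :=
      evalAt_split p a
    have hflip : ∀ x, evalAt p (flipAt a x)
        = evalAt q x - (((x a : ℤˣ) : ℤ) : ℝ) * evalAt r x := by
      intro x
      rw [hsplit, evalAt_flipAt_of_support q a (fun I h => by simp [hq, h]),
        evalAt_flipAt_of_support r a (fun I h => by simp [hr, h]), flipAt, Function.update_self]
      push_cast
      ring
    -- Averaging over the flip of `x_a` cancels the terms odd in `x_a`, since `q` and `r` do not
    -- involve it.
    have h4 : ∑ x, evalAt p x ^ 4 = ∑ x, evalAt q x ^ 4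
        + 6 * ∑ x, evalAt q x ^ 2 * evalAt r x ^ 2 + ∑ x, evalAt r x ^ 4 := by
      have h := sum_flipAt a (fun x => evalAt p x ^ 4)
      have e : 2 * ∑ x, evalAt p x ^ 4 = ∑ x, (evalAt p (flipAt a x) ^ 4 + evalAt p x ^ 4) := by
        rw [Finset.sum_add_distrib, h]
        ring
      have e2 : ∀ x, evalAt p (flipAt a x) ^ 4 + evalAt p x ^ 4
          = 2 * (evalAt q x ^ 4 + 6 * (evalAt q x ^ 2 * evalAt r x ^ 2) + evalAt r x ^ 4) := by
        intro x
        have hx := coord_sq x a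
        rw [hflip, hsplit]
        set u := (((x a : ℤˣ) : ℤ) : ℝ)
        have hx4 : u ^ 4 = 1 := by rw [show u ^ 4 = (u ^ 2) ^ 2 by ring, hx, one_pow]
        linear_combination (12 * evalAt q x ^ 2 * evalAt r x ^ 2) * hx + 2 * evalAt r x ^ 4 * hx4
      rw [Finset.sum_congr rfl fun x _ => e2 x, ← Finset.mul_sum, Finset.sum_add_distrib,
        Finset.sum_add_distrib, ← Finset.mul_sum] at e
      linarith
    have h2 : ∑ x, evalAt p x ^ 2 = ∑ x, evalAt q x ^ 2 + ∑ x, evalAt r x ^ 2 := by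
      have h := sum_flipAt a (fun x => evalAt p x ^ 2)
      have e : 2 * ∑ x, evalAt p x ^ 2 = ∑ x, (evalAt p (flipAt a x) ^ 2 + evalAt p x ^ 2) := by
        rw [Finset.sum_add_distrib, h]
        ring
      have e2 : ∀ x, evalAt p (flipAt a x) ^ 2 + evalAt p x ^ 2
          = 2 * (evalAt q x ^ 2 + evalAt r x ^ 2) := by
        intro x
        have hx := coord_sq x a
        rw [hflip, hsplit]
        linear_combination (2 * evalAt r x ^ 2) * hx
      rw [Finset.sum_congr rfl fun x _ => e2 x, ← Finset.mul_sum, Finset.sum_add_distrib] at e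
      linarith
    have hcs : (∑ x, evalAt q x ^ 2 * evalAt r x ^ 2) ^ 2
        ≤ (∑ x, evalAt q x ^ 4) * ∑ x, evalAt r x ^ 4 := by
      have := Finset.sum_mul_sq_le_sq_mul_sq Finset.univ (fun x => evalAt q x ^ 2)
        (fun x => evalAt r x ^ 2)
      simpa only [← pow_mul] using this
    rw [h4, h2]
    have hn := card_cube_pos d
    set n : ℝ := (Fintype.card (Cube d) : ℝ)
    have hA : 0 ≤ ∑ x, evalAt q x ^ 2 := Finset.sum_nonneg fun x _ => sq_nonneg _
    have hB : 0 ≤ ∑ x, evalAt r x ^ 2 := Finset.sum_nonneg fun x _ => sq_nonneg _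
    have hR4 : 0 ≤ ∑ x, evalAt r x ^ 4 := Finset.sum_nonneg fun x _ => by positivity
    generalize ∑ x, evalAt q x ^ 2 = A at *
    generalize ∑ x, evalAt r x ^ 2 = B at *
    generalize ∑ x, evalAt q x ^ 4 = Q at *
    generalize ∑ x, evalAt r x ^ 4 = R at *
    generalize ∑ x, evalAt q x ^ 2 * evalAt r x ^ 2 = X at *
    have h9 : (0 : ℝ) < 9 ^ k := by positivity
    -- As `r` has degree one less, Cauchy–Schwarz gives the factor `√(9^(k+1) · 9^k)`. Then `6 · 3 ·
    -- 9^k = 2 · 9^(k+1)` completes the square `(A + B)²`.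
    have hX : n * X ≤ 3 * 9 ^ k * A * B := by
      refine abs_le_of_sq_le_sq' ?_ (by positivity) |>.2
      calc (n * X) ^ 2 = n ^ 2 * X ^ 2 := by ring
        _ ≤ n ^ 2 * (Q * R) := by gcongr
        _ = (n * Q) * (n * R) := by ring
        _ ≤ (9 ^ (k + 1) * A ^ 2) * (9 ^ k * B ^ 2) :=
          mul_le_mul hqs hrs (by positivity) (by positivity)
        _ = (3 * 9 ^ k * A * B) ^ 2 := by ring
    have hB2 : 9 ^ k * B ^ 2 ≤ 9 ^ (k + 1) * B ^ 2 := by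
      gcongr
      · norm_num
      · omega
    calc n * (Q + 6 * X + R) = n * Q + 6 * (n * X) + n * R := by ring
      _ ≤ 9 ^ (k + 1) * A ^ 2 + 6 * (3 * 9 ^ k * A * B) + 9 ^ (k + 1) * B ^ 2 := by linarith
      _ = _ := by ring

/-- Hypercontractivity between the first two moments of a non-negative polynomial. -/
theorem card_mul_sum_sq_le {d k : ℕ} {p : CubePoly d} (hp : DegLE k p)
    (h0 : ∀ x, 0 ≤ evalAt p x) :
    Fintype.card (Cube d) * ∑ x, evalAt p x ^ 2 ≤ 9 ^ k * (∑ x, evalAt p x) ^ 2 := by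
  have h4 := sum_pow_four_le Finset.univ k p fun I hI =>
    ⟨Finset.subset_univ _, not_lt.1 fun h => hI (hp I h)⟩
  have c1 : (∑ x, evalAt p x ^ 2) ^ 2 ≤ (∑ x, evalAt p x) * ∑ x, evalAt p x ^ 3 :=
    Finset.sum_sq_le_sum_mul_sum_of_sq_le_mul _ (fun x _ => h0 x)
      (fun x _ => pow_nonneg (h0 x) 3) fun x _ => le_of_eq (by ring)
  have c2 : (∑ x, evalAt p x ^ 3) ^ 2 ≤ (∑ x, evalAt p x ^ 2) * ∑ x, evalAt p x ^ 4 :=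
    Finset.sum_sq_le_sum_mul_sum_of_sq_le_mul _ (fun x _ => sq_nonneg _)
      (fun x _ => pow_nonneg (h0 x) 4) fun x _ => le_of_eq (by ring)
  have p2 : 0 ≤ ∑ x, evalAt p x ^ 2 := Finset.sum_nonneg fun x _ => sq_nonneg _
  have hn := card_cube_pos d
  set n : ℝ := (Fintype.card (Cube d) : ℝ)
  generalize ∑ x, evalAt p x ^ 2 = A at *
  generalize ∑ x, evalAt p x ^ 3 = T at *
  generalize ∑ x, evalAt p x ^ 4 = Q at *
  generalize ∑ x, evalAt p x = E at *
  rcases p2.eq_or_lt with rfl | hA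
  · rw [mul_zero]
    positivity
  -- The two Cauchy–Schwarz steps eliminate the third moment; the fourth is then controlled by
  -- Bonami's lemma.
  have c3 : A ^ 4 ≤ E ^ 2 * (A * Q) := by
    calc A ^ 4 = (A ^ 2) ^ 2 := by ring
      _ ≤ (E * T) ^ 2 := by gcongr
      _ = E ^ 2 * T ^ 2 := by ring
      _ ≤ _ := by gcongr
  have c4 : A ^ 3 * (n * A) ≤ A ^ 3 * (9 ^ k * E ^ 2) := by
    calc A ^ 3 * (n * A) = n * A ^ 4 := by ring
      _ ≤ n * (E ^ 2 * (A * Q)) := by gcongr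
      _ = E ^ 2 * A * (n * Q) := by ring
      _ ≤ E ^ 2 * A * (9 ^ k * A ^ 2) := by gcongr
      _ = _ := by ring
  exact le_of_mul_le_mul_left c4 (by positivity)

/-- Non-negative polynomials with a small mean have small coefficients. -/
theorem coefNorm_sq_le {d k : ℕ} {p : CubePoly d} (hp : DegLE k p)
    (h0 : ∀ x, 0 ≤ evalAt p x) :
    coefNorm p ^ 2 ≤ (lowMonomials d k).card * (9 ^ k * unifMean p ^ 2) := by
  have h := card_mul_sum_sq_le hp h0
  rw [sum_sq_evalAt, sum_evalAt, ← unifMean_eq p] at h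
  have hn := card_cube_pos d
  have h1 : ∑ I, p I ^ 2 ≤ 9 ^ k * unifMean p ^ 2 := by
    refine le_of_mul_le_mul_left ?_ (by positivity : (0 : ℝ) < (Fintype.card (Cube d) : ℝ) ^ 2)
    linarith
  have h2 : coefNorm p = ∑ I ∈ lowMonomials d k, |p I| := by
    refine (Finset.sum_subset (Finset.subset_univ _) fun I _ hI => ?_).symm
    rw [mem_lowMonomials, not_le] at hI
    rw [hp I hI, abs_zero]
  have h3 : ∑ I ∈ lowMonomials d k, |p I| ^ 2 ≤ ∑ I, p I ^ 2 := by
    simp only [sq_abs]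
    exact Finset.sum_le_sum_of_subset_of_nonneg (Finset.subset_univ _) fun _ _ _ => sq_nonneg _
  rw [h2]
  refine sq_sum_le_card_mul_sum_sq.trans ?_
  gcongr
  exact h3.trans h1

/-! ### Concentration of monomials over a sample -/

/-- Concentration of a monomial over a uniform sample. -/
theorem card_lt_sum_monomialAt_le {N d : ℕ} {I : Finset (Fin d)} (hI : I ≠ ∅) (s : ℝ)
    (hs : |s| = 1) {t : ℝ} (ht : 0 ≤ t) (hN : 0 < N) :
    (Nat.card {y : Sample N d // t < ∑ i, s * monomialAt I (y i)} : ℝ)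
      ≤ (Fintype.card (Cube d) : ℝ) ^ N * Real.exp (-(t ^ 2 / (2 * N))) := by
  refine card_lt_sum_le (fun _ y => s * monomialAt I y) (fun _ => 1) N t (by exact_mod_cast hN) ht
    (by simp) fun i l => ?_
  -- On the values `±1` the exponential is affine, and the linear part sums to 0 over the cube.
  have h : ∀ y : Cube d, Real.exp (l * (s * monomialAt I y))
      = Real.cosh l + (s * monomialAt I y) * Real.sinh l := by
    intro y
    have h1 : |s * monomialAt I y| = 1 := by rw [abs_mul, hs, abs_monomialAt, one_mul]
    rcases (abs_eq zero_le_one).1 h1 with h | h <;> rw [h]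
    · rw [mul_one, one_mul, Real.cosh_add_sinh]
    · rw [mul_neg_one, neg_one_mul, ← sub_eq_add_neg, Real.cosh_sub_sinh]
  rw [Finset.sum_congr rfl fun y _ => h y, Finset.sum_add_distrib, ← Finset.sum_mul,
    ← Finset.mul_sum, sum_monomialAt hI]
  simp only [Finset.sum_const, Finset.card_univ, nsmul_eq_mul, mul_zero, zero_mul, add_zero,
    mul_one]
  gcongr
  exact Real.cosh_le_exp_half_sq l

/-- All low-degree monomials concentrate at once. -/
theorem card_not_balanced_le {N d k : ℕ} {t : ℝ} (ht : 0 ≤ t) (hN : 0 < N) :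
    (Nat.card {y : Sample N d // ¬ ∀ I ∈ (lowMonomials d k).erase ∅,
        |∑ i, monomialAt I (y i)| ≤ t} : ℝ)
      ≤ (Fintype.card (Sample N d)) * (2 * (d : ℝ) ^ k * Real.exp (-(t ^ 2 / (2 * N)))) := by
  classical
  let bad : Finset (Fin d) → ℝ → Finset (Sample N d) := fun I s =>
    Finset.univ.filter fun y => t < ∑ i, s * monomialAt I (y i)
  have hsub : (Finset.univ.filter fun y : Sample N d => ¬ ∀ I ∈ (lowMonomials d k).erase ∅,
        |∑ i, monomialAt I (y i)| ≤ t)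
      ⊆ ((lowMonomials d k).erase ∅).biUnion fun I => bad I 1 ∪ bad I (-1) := by
    intro y hy
    simp only [Finset.mem_filter, Finset.mem_univ, true_and] at hy
    push Not at hy
    obtain ⟨I, hI, hlt⟩ := hy
    refine Finset.mem_biUnion.2 ⟨I, hI, ?_⟩
    simp only [bad, Finset.mem_union, Finset.mem_filter, Finset.mem_univ, true_and,
      ← Finset.mul_sum]
    rcases lt_abs.1 hlt with h | h
    · left
      linarith
    · right
      linarith
  set c : ℝ := (Fintype.card (Cube d) : ℝ) ^ N * Real.exp (-(t ^ 2 / (2 * N))) with hc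
  have hbad : ∀ I ∈ (lowMonomials d k).erase ∅, (((bad I 1 ∪ bad I (-1)).card : ℕ) : ℝ)
      ≤ 2 * c := by
    intro I hI
    have h := fun s hs => card_lt_sum_monomialAt_le (N := N) (Finset.ne_of_mem_erase hI) s hs ht hN
    simp only [Nat.card_eq_fintype_card, Fintype.card_subtype] at h
    have h1 := h 1 (by simp)
    have h2 := h (-1) (by simp)
    have h3 : (((bad I 1 ∪ bad I (-1)).card : ℕ) : ℝ) ≤ (bad I 1).card + (bad I (-1)).card := by
      exact_mod_cast Finset.card_union_le _ _
    linarith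
  rw [Nat.card_eq_fintype_card, Fintype.card_subtype]
  have h1 := (Finset.card_le_card hsub).trans Finset.card_biUnion_le
  have h2 : (_ : ℝ) ≤ _ := Nat.cast_le (α := ℝ).2 h1
  push_cast at h2
  refine h2.trans ((Finset.sum_le_card_nsmul _ _ _ hbad).trans ?_)
  rw [nsmul_eq_mul]
  have h3 : ((((lowMonomials d k).erase ∅).card : ℕ) : ℝ) ≤ (d : ℝ) ^ k := by
    exact_mod_cast card_nonempty_lowMonomials_le d k
  have h4 : (Fintype.card (Sample N d) : ℝ) = (Fintype.card (Cube d) : ℝ) ^ N := by simp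
  rw [h4]
  have hc0 : 0 ≤ c := by positivity
  calc _ ≤ (d : ℝ) ^ k * (2 * c) := by gcongr
    _ = _ := by rw [hc]; ring

theorem card_snd_not {A B : Type} [Fintype A] [Fintype B] (E : B → Prop) :
    Nat.card {ω : A × B // ¬ E ω.2} = Fintype.card A * Nat.card {b // ¬ E b} := by
  classical
  rw [Nat.card_eq_fintype_card, Nat.card_eq_fintype_card, Fintype.card_subtype,
    Fintype.card_subtype, ← Finset.card_univ, ← Finset.card_product]
  congr 1
  ext ω
  simp

/-- On a sample on which the low-degree monomials are balanced, means are nearly uniform means. -/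
theorem mean_le_of_balanced {N d k : ℕ} {p : CubePoly d} (hp : DegLE k p) {y : Sample N d}
    {β : ℝ} (hN : 0 < N)
    (hy : ∀ I ∈ (lowMonomials d k).erase ∅, |∑ i, monomialAt I (y i)| ≤ N * β) (hβ : 0 ≤ β) :
    1 / (N : ℝ) * ∑ i, evalAt p (y i) ≤ unifMean p + coefNorm p * β := by
  have hN' : (0 : ℝ) < N := by exact_mod_cast hN
  rw [one_div, inv_mul_le_iff₀ hN']
  simp only [evalAt_eq_sum_lowMonomials hp]
  rw [Finset.sum_comm, ← Finset.add_sum_erase _ _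
    (mem_lowMonomials.2 (by simp) : ∅ ∈ lowMonomials d k)]
  have h1 : ∑ i : Fin N, p ∅ * monomialAt ∅ (y i) = N * unifMean p := by
    simp [monomialAt, unifMean_eq]
  have h2 : ∑ I ∈ (lowMonomials d k).erase ∅, ∑ i, p I * monomialAt I (y i)
      ≤ ∑ I ∈ (lowMonomials d k).erase ∅, |p I| * (N * β) := by
    refine Finset.sum_le_sum fun I hI => ?_
    rw [← Finset.mul_sum]
    refine (le_abs_self _).trans ?_
    rw [abs_mul]
    exact mul_le_mul_of_nonneg_left (hy I hI) (abs_nonneg _)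
  have h3 : ∑ I ∈ (lowMonomials d k).erase ∅, |p I| ≤ coefNorm p :=
    Finset.sum_le_sum_of_subset_of_nonneg (Finset.subset_univ _) fun _ _ _ => abs_nonneg _
  rw [← Finset.sum_mul] at h2
  have h4 := mul_le_mul_of_nonneg_right h3 (by positivity : 0 ≤ N * β)
  rw [h1]
  linarith

/-! ### The linear program and its constants -/

theorem abs_evalAt_le {d : ℕ} (p : CubePoly d) (x : Cube d) : |evalAt p x| ≤ coefNorm p := by
  rw [evalAt_eq_sum]
  refine (Finset.abs_sum_le_sum_abs _ _).trans (le_of_eq ?_)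
  exact Finset.sum_congr rfl fun I _ => by rw [abs_mul, abs_monomialAt, mul_one]

theorem coefBound_nonneg (d k : ℕ) : 0 ≤ coefBound d k := by
  unfold coefBound
  positivity

theorem coefBound_sq (d k : ℕ) : coefBound d k ^ 2 = 9 ^ k * (d : ℝ) ^ k := by
  unfold coefBound
  rw [mul_pow, ← pow_mul, mul_comm k 2, pow_mul, ← Real.rpow_natCast ((d : ℝ) ^ ((k : ℝ) / 2)),
    ← Real.rpow_mul (by positivity)]
  norm_num

theorem slack_nonneg (d k : ℕ) {ε : ℝ} (hε : 0 ≤ ε) : 0 ≤ slack d k ε := by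
  have := coefBound_nonneg d k
  unfold slack
  positivity

/-- Only an inequality: for `d = 0 < k` the bound `B` is 0, and division by zero makes the slack 0.
-/
theorem slack_mul_coefBound_le (d k : ℕ) {ε : ℝ} (hε : 0 ≤ ε) :
    slack d k ε * coefBound d k ≤ ε / 2 := by
  unfold slack
  rcases (coefBound_nonneg d k).eq_or_lt with h | h
  · rw [← h]
    simp only [mul_zero]
    positivity
  · exact le_of_eq (by field_simp)

theorem continuous_evalAt {d : ℕ} (x : Cube d) : Continuous fun p : CubePoly d => evalAt p x := by
  unfold evalAt
  fun_prop

theorem continuous_coefNorm {d : ℕ} : Continuous fun p : CubePoly d => coefNorm p := by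
  unfold coefNorm
  fun_prop

theorem isFeasible_zero {N d k : ℕ} {ε : ℝ} (hε : 0 ≤ ε) (ref inp : Sample N d) :
    IsFeasible k ε ref inp 0 := by
  have h : ∀ x : Cube d, evalAt 0 x = 0 := fun x => by simp [evalAt]
  refine ⟨fun I _ => rfl, ?_, fun i => (h _).ge, fun i => (h _).ge, ?_⟩
  · simpa [coefNorm] using coefBound_nonneg d k
  · simp only [h, Finset.sum_const_zero, mul_zero]
    positivity

/-- The coefficient bound keeps the closed feasible region bounded, so the continuous objective
attains its maximum. -/
theorem isCompact_feasible {N d k : ℕ} {ε : ℝ} (ref inp : Sample N d) :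
    IsCompact {p : CubePoly d | IsFeasible k ε ref inp p} := by
  refine Metric.isCompact_of_isClosed_isBounded ?_ ?_
  · simp only [IsFeasible, DegLE, Set.ofPred_and, Set.ofPred_forall]
    refine (isClosed_iInter fun I => isClosed_iInter fun _ =>
      isClosed_eq (continuous_apply I) continuous_const).inter
      ((isClosed_le continuous_coefNorm continuous_const).inter
      ((isClosed_iInter fun i => isClosed_le continuous_const (continuous_evalAt _)).inter
      ((isClosed_iInter fun i => isClosed_le continuous_const (continuous_evalAt _)).inter
      (isClosed_le (continuous_const.mul (continuous_finsetSum _ fun i _ => continuous_evalAt _))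
        continuous_const))))
  · refine (Metric.isBounded_closedBall (x := (0 : CubePoly d)) (r := coefBound d k)).subset ?_
    intro p hp
    rw [mem_closedBall_zero_iff, pi_norm_le_iff_of_nonneg (coefBound_nonneg d k)]
    intro I
    rw [Real.norm_eq_abs]
    exact (Finset.single_le_sum (f := fun I => |p I|) (fun I _ => abs_nonneg _)
      (Finset.mem_univ I)).trans hp.2.1

theorem exists_isSolution {N d k : ℕ} {ε : ℝ} (hε : 0 ≤ ε) (ref inp : Sample N d)
    (S : Finset (Fin N)) : ∃ p, IsSolution k ε ref inp S p := by
  obtain ⟨p, hp, hmax⟩ := (isCompact_feasible (k := k) (ε := ε) ref inp).exists_isMaxOn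
    ⟨0, isFeasible_zero hε ref inp⟩
    (continuous_finsetSum S fun i _ => continuous_evalAt (inp i)).continuousOn
  exact ⟨p, hp, fun q hq => hmax hq⟩

/-! ### Layer cake and the existence of thresholds -/

theorem integral_lt_indicator {v B : ℝ} (h0 : 0 ≤ v) (hB : v ≤ B) :
    ∫ t in (0 : ℝ)..B, (if t < v then (1 : ℝ) else 0) = v := by
  have e : (fun t : ℝ => if t < v then (1 : ℝ) else 0) = (Set.Iio v).indicator 1 := by
    ext t
    simp [Set.indicator]
  rw [e, intervalIntegral.integral_of_le (h0.trans hB),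
    MeasureTheory.setIntegral_indicator measurableSet_Iio]
  have e2 : Set.Ioc 0 B ∩ Set.Iio v = Set.Ioo 0 v := by
    ext t
    simp only [Set.mem_inter_iff, Set.mem_Ioc, Set.mem_Iio, Set.mem_Ioo]
    constructor
    · rintro ⟨⟨h1, -⟩, h2⟩
      exact ⟨h1, h2⟩
    · rintro ⟨h1, h2⟩
      exact ⟨⟨h1, h2.le.trans hB⟩, h2⟩
  rw [e2]
  simp [h0]

theorem intervalIntegrable_lt_indicator (v a b : ℝ) :
    IntervalIntegrable (fun t : ℝ => if t < v then (1 : ℝ) else 0) MeasureTheory.volume a b := by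
  refine Antitone.intervalIntegrable fun s t hst => ?_
  split_ifs with h1 h2
  · exact le_rfl
  · exact absurd (hst.trans_lt h1) h2
  · exact zero_le_one
  · exact le_rfl

open Classical in
/-- The examples with index in `S` at which `p` exceeds `τ`. -/
noncomputable def tailSet {N d : ℕ} (smp : Sample N d) (S : Finset (Fin N)) (p : CubePoly d)
    (τ : ℝ) : Finset (Fin N) :=
  S.filter fun i => τ < evalAt p (smp i)

theorem mem_tailSet {N d : ℕ} {smp : Sample N d} {S : Finset (Fin N)} {p : CubePoly d} {τ : ℝ}
    {i : Fin N} : i ∈ tailSet smp S p τ ↔ i ∈ S ∧ τ < evalAt p (smp i) := by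
  simp [tailSet]

theorem card_div_mul_tailProb {N d : ℕ} (smp : Sample N d) (S : Finset (Fin N)) (p : CubePoly d)
    (τ : ℝ) : (S.card : ℝ) / N * tailProb smp S p τ = (tailSet smp S p τ).card / (N : ℝ) := by
  unfold tailProb
  change (S.card : ℝ) / N * ((tailSet smp S p τ).card / (S.card : ℝ)) = _
  rcases S.eq_empty_or_nonempty with rfl | hS
  · simp [tailSet]
  · have : (S.card : ℝ) ≠ 0 := by exact_mod_cast hS.card_pos.ne'
    field_simp

theorem tailProb_univ {N d : ℕ} (smp : Sample N d) (p : CubePoly d) (τ : ℝ) :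
    tailProb smp Finset.univ p τ = (tailSet smp Finset.univ p τ).card / (N : ℝ) := by
  unfold tailProb tailSet
  rw [Finset.card_univ, Fintype.card_fin]

/-- The layer-cake formula for the sum of `p` over a set of examples. -/
theorem integral_card_tailSet {N d : ℕ} (smp : Sample N d) (S : Finset (Fin N)) (p : CubePoly d)
    {B : ℝ} (h0 : ∀ i, 0 ≤ evalAt p (smp i)) (hB : ∀ i, evalAt p (smp i) ≤ B) :
    IntervalIntegrable (fun t => ((tailSet smp S p t).card : ℝ)) MeasureTheory.volume 0 B ∧
      ∫ t in (0 : ℝ)..B, ((tailSet smp S p t).card : ℝ) = ∑ i ∈ S, evalAt p (smp i) := by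
  have e : (fun t => ((tailSet smp S p t).card : ℝ))
      = fun t => ∑ i ∈ S, if t < evalAt p (smp i) then (1 : ℝ) else 0 := by
    ext t
    simp [tailSet]
  rw [e]
  refine ⟨?_, ?_⟩
  · have := IntervalIntegrable.sum S (f := fun i t => if t < evalAt p (smp i) then (1 : ℝ) else 0)
      (fun i _ => intervalIntegrable_lt_indicator (evalAt p (smp i)) 0 B)
    refine Eq.mp (congrArg (IntervalIntegrable · MeasureTheory.volume 0 B) ?_) this
    ext t
    exact Finset.sum_apply _ _ _
  · rw [intervalIntegral.integral_finsetSum fun i _ => intervalIntegrable_lt_indicator _ 0 B]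
    exact Finset.sum_congr rfl fun i _ => integral_lt_indicator (h0 i) (hB i)

theorem pos_of_lt_score {N d : ℕ} {ε : ℝ} (hε : 0 < ε) {inp : Sample N d} {S : Finset (Fin N)}
    {p : CubePoly d} (h : ε < score inp S p) : 0 < N ∧ S.Nonempty := by
  refine ⟨Nat.pos_of_ne_zero ?_, Finset.nonempty_iff_ne_empty.2 ?_⟩
  · rintro rfl
    simp only [score, Nat.cast_zero, div_zero, zero_mul] at h
    linarith
  · rintro rfl
    simp only [score, Finset.sum_empty, mul_zero] at h
    linarith

theorem IsFeasible.evalAt_le {N d k : ℕ} {ε : ℝ} {ref inp : Sample N d} {p : CubePoly d}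
    (hp : IsFeasible k ε ref inp p) (x : Cube d) : evalAt p x ≤ coefBound d k :=
  ((le_abs_self _).trans (abs_evalAt_le p x)).trans hp.2.1

/-- A filtering step finds some admissible threshold. -/
theorem exists_threshold_condition {N d k : ℕ} {ε : ℝ} (hε : 0 < ε) {ref inp : Sample N d}
    {S : Finset (Fin N)} {p : CubePoly d} (hp : IsFeasible k ε ref inp p)
    (h : ε < score inp S p) :
    ∃ t, 0 ≤ t ∧ 2 * tailProb ref Finset.univ p t + slack d k ε
      ≤ (S.card : ℝ) / (N : ℝ) * tailProb inp S p t := by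
  by_contra! hcon
  have hN : (0 : ℝ) < N := by exact_mod_cast (pos_of_lt_score hε h).1
  obtain ⟨-, -, href, hinp, hmean⟩ := id hp
  obtain ⟨i1, e1⟩ := integral_card_tailSet inp S p hinp fun i => hp.evalAt_le _
  obtain ⟨i2, e2⟩ := integral_card_tailSet ref Finset.univ p href fun i => hp.evalAt_le _
  -- Integrating the failed conditions over `[0, B]` gives a score of at most `2 · ε/4 + Δ B ≤ ε`.
  have hmono := intervalIntegral.integral_mono_on (coefBound_nonneg d k) (i1.div_const (N : ℝ))
    (((i2.div_const (N : ℝ)).const_mul 2).add (intervalIntegrable_const (c := slack d k ε)))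
    fun t ht => by
      have := hcon t ht.1
      rw [card_div_mul_tailProb, tailProb_univ] at this
      exact this.le
  rw [intervalIntegral.integral_add ((i2.div_const (N : ℝ)).const_mul 2) intervalIntegrable_const,
    intervalIntegral.integral_const_mul, intervalIntegral.integral_div,
    intervalIntegral.integral_div, e1, e2, intervalIntegral.integral_const, smul_eq_mul,
    sub_zero, mul_comm (coefBound d k)] at hmono
  have h1 := slack_mul_coefBound_le d k hε.le
  rw [one_div, inv_mul_eq_div] at hmean
  rw [score, one_div, inv_mul_eq_div] at h
  linarith

/-- Strict tails are constant from one value of `p` on the samples up to just below the next. Every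
admissible `t` thus rounds down to an admissible point of the finite set `W`, where a minimum
exists. -/
theorem exists_isThreshold {N d k : ℕ} {ε : ℝ} (hε : 0 < ε) {ref inp : Sample N d}
    {S : Finset (Fin N)} {p : CubePoly d} (hp : IsFeasible k ε ref inp p)
    (h : ε < score inp S p) : ∃ τ, IsThreshold k ε ref inp S p τ := by
  classical
  let W : Finset ℝ := insert 0
    (Finset.univ.image (fun i => evalAt p (ref i)) ∪ Finset.univ.image fun i => evalAt p (inp i))
  let T : Set ℝ := {t : ℝ | 0 ≤ t ∧ 2 * tailProb ref Finset.univ p t + slack d k ε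
      ≤ (S.card : ℝ) / (N : ℝ) * tailProb inp S p t}
  have hround : ∀ t ∈ T, ∃ w ∈ W, w ∈ T ∧ w ≤ t := by
    rintro t ⟨ht0, ht⟩
    obtain ⟨w, hw, hmax⟩ := (W.filter fun w => w ≤ t).exists_max_image id
      ⟨0, by simp [W, ht0]⟩
    rw [Finset.mem_filter] at hw
    have hsame : ∀ v ∈ W, (t < v ↔ w < v) := by
      intro v hv
      refine ⟨fun h => hw.2.trans_lt h, fun h => ?_⟩
      by_contra! hc
      exact absurd (hmax v (Finset.mem_filter.2 ⟨hv, hc⟩)) (not_le.2 h)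
    have h1 : tailSet ref Finset.univ p w = tailSet ref Finset.univ p t := by
      ext i
      rw [mem_tailSet, mem_tailSet, hsame _ (by simp [W])]
    have h2 : tailSet inp S p w = tailSet inp S p t := by
      ext i
      rw [mem_tailSet, mem_tailSet, hsame _ (by simp [W])]
    refine ⟨w, hw.1, ⟨hmax 0 (by simp [W, ht0]), ?_⟩, hw.2⟩
    rw [card_div_mul_tailProb, tailProb_univ] at ht ⊢
    rwa [h1, h2]
  obtain ⟨t, ht⟩ := exists_threshold_condition hε hp h
  obtain ⟨w, hwW, hwT, -⟩ := hround t ht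
  obtain ⟨τ, hτ, hmin⟩ := (W.filter fun w => w ∈ T).exists_min_image id
    ⟨w, Finset.mem_filter.2 ⟨hwW, hwT⟩⟩
  refine ⟨τ, (Finset.mem_filter.1 hτ).2, fun s hs => ?_⟩
  obtain ⟨v, hvW, hvT, hvs⟩ := hround s hs
  exact (hmin v (Finset.mem_filter.2 ⟨hvW, hvT⟩)).trans hvs

/-! ### Progress and safety of the filtering steps -/

theorem IsThreshold.le_card {N d k : ℕ} {ε τ : ℝ} {ref inp : Sample N d}
    {S : Finset (Fin N)} {p : CubePoly d} (hN : 0 < N) (hτ : IsThreshold k ε ref inp S p τ) :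
    2 * ((tailSet ref Finset.univ p τ).card : ℝ) + N * slack d k ε
      ≤ (tailSet inp S p τ).card := by
  have h := hτ.1.2
  have hN' : (0 : ℝ) < N := by exact_mod_cast hN
  rw [card_div_mul_tailProb, tailProb_univ, le_div_iff₀ hN'] at h
  have e : (2 * (((tailSet ref Finset.univ p τ).card : ℝ) / N) + slack d k ε) * N
      = 2 * ((tailSet ref Finset.univ p τ).card : ℝ) + N * slack d k ε := by
    field_simp
  rwa [e] at h

/-- If `B = 0`, feasible polynomials are nowhere positive and the score cannot exceed `ε`; so the
degenerate slack 0 never occurs in a filtering step. -/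
theorem slack_pos_of_lt_score {N d k : ℕ} {ε : ℝ} (hε : 0 < ε) {ref inp : Sample N d}
    {S : Finset (Fin N)} {p : CubePoly d} (hp : IsFeasible k ε ref inp p)
    (h : ε < score inp S p) : 0 < slack d k ε := by
  have hB : 0 < coefBound d k := by
    by_contra! hc
    have hs : ∑ i ∈ S, evalAt p (inp i) ≤ 0 :=
      Finset.sum_nonpos fun i _ => (hp.evalAt_le _).trans hc
    have : score inp S p ≤ 0 := mul_nonpos_of_nonneg_of_nonpos (by positivity) hs
    linarith
  unfold slack
  positivity

/-- The threshold condition forces a tail of at least `N Δ > 0` examples, so every step removes at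
least one. -/
theorem Reaches.add_card_le {N d k : ℕ} {ε : ℝ} (hε : 0 < ε) {ref inp : Sample N d} {i : ℕ}
    {S : Finset (Fin N)} (h : Reaches k ε ref inp i S) : i + S.card ≤ N := by
  induction h with
  | start => simp
  | @step i S p τ _ hsol hscore hτ ih =>
    have h1 := hτ.le_card (pos_of_lt_score hε hscore).1
    have h2 : (0 : ℝ) < N * slack d k ε :=
      mul_pos (by exact_mod_cast (pos_of_lt_score hε hscore).1)
        (slack_pos_of_lt_score hε hsol.1 hscore)
    have h3 : (0 : ℝ) < (tailSet inp S p τ).card := by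
      have : (0 : ℝ) ≤ (tailSet ref Finset.univ p τ).card := Nat.cast_nonneg _
      linarith
    have h4 : 0 < (tailSet inp S p τ).card := by exact_mod_cast h3
    change i + 1 + (S \ tailSet inp S p τ).card ≤ N
    have hsub : tailSet inp S p τ ⊆ S := Finset.filter_subset _ _
    have h5 := Finset.card_sdiff_add_card_eq_card hsub
    omega

theorem alwaysOutputs {N d : ℕ} (k : ℕ) {ε : ℝ} (hε : 0 < ε) (ref inp : Sample N d) :
    AlwaysOutputs k ε ref inp := by
  intro i S hS
  refine ⟨exists_isSolution hε.le ref inp S, fun p hp hscore =>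
    ⟨?_, exists_isThreshold hε hp.1 hscore⟩⟩
  have h1 := hS.add_card_le hε
  have h2 := (pos_of_lt_score hε hscore).2.card_pos
  omega

/-- Subtracting `τ` from the constant coefficient turns tails into positivity sets without raising
the degree bound; `q` does not depend on the sample. -/
theorem card_tailSet_univ {N d k : ℕ} {p : CubePoly d} (hp : DegLE k p) (τ : ℝ) :
    ∃ q : CubePoly d, DegLE k q ∧
      ∀ y : Sample N d, ((tailSet y Finset.univ p τ).card : ℝ) = posCount q y := by
  classical
  refine ⟨fun I => p I - if I = ∅ then τ else 0, fun I hI => ?_, fun y => ?_⟩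
  · have hne : I ≠ ∅ := by
      rintro rfl
      simp at hI
    simp [hp I hI, hne]
  · have h : ∀ x, evalAt (fun I => p I - if I = ∅ then τ else 0) x = evalAt p x - τ := by
      intro x
      simp only [evalAt_eq_sum, sub_mul, Finset.sum_sub_distrib]
      simp [monomialAt]
    simp only [posCount, tailSet, h, sub_pos]

/-- If polynomial inequalities are equally frequent in the clean and in the reference sample,
every filtering step removes no more clean than adversarial examples. -/
theorem Reaches.card_clean_le {N d k : ℕ} {ε η : ℝ} (hε : 0 < ε) {cln ref inp : Sample N d}
    {R : Finset (Fin N)} (hgood : ∀ q : CubePoly d, DegLE k q →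
      posCount q cln ≤ posCount q ref + N * (slack d k ε / 2))
    (hcont : IsContamination η cln R inp) {i : ℕ} {S : Finset (Fin N)}
    (h : Reaches k ε ref inp i S) : (Rᶜ \ S).card ≤ (R \ S).card := by
  classical
  induction h with
  | start =>
    exact Finset.card_le_card fun j hj =>
      absurd (Finset.mem_univ j) (Finset.mem_sdiff.1 hj).2
  | @step i S p τ _ hsol hscore hτ ih =>
    change (Rᶜ \ (S \ tailSet inp S p τ)).card ≤ (R \ (S \ tailSet inp S p τ)).card
    set D := tailSet inp S p τ with hD
    have hDS : D ⊆ S := Finset.filter_subset _ _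
    have hsplit : ∀ Q : Finset (Fin N), (Q \ (S \ D)).card = (Q \ S).card + (Q ∩ D).card := by
      intro Q
      rw [← Finset.card_union_of_disjoint]
      · congr 1
        ext j
        have := @hDS j
        simp only [Finset.mem_sdiff, Finset.mem_union, Finset.mem_inter]
        tauto
      · rw [Finset.disjoint_left]
        intro j h1 h2
        exact (Finset.mem_sdiff.1 h1).2 (hDS (Finset.mem_inter.1 h2).2)
    have h1 := hτ.le_card (pos_of_lt_score hε hscore).1
    obtain ⟨q, hq, hcount⟩ := card_tailSet_univ (N := N) hsol.1.1 τ
    have h2 : (Rᶜ ∩ D).card ≤ (tailSet cln Finset.univ p τ).card := by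
      refine Finset.card_le_card fun j hj => ?_
      rw [Finset.mem_inter, Finset.mem_compl, hD, mem_tailSet] at hj
      rw [mem_tailSet, ← hcont.2 j hj.1]
      exact ⟨Finset.mem_univ _, hj.2.2⟩
    have h3 : ((Rᶜ ∩ D).card : ℝ) ≤ posCount q cln := by
      rw [← hcount]
      exact_mod_cast h2
    have h4 := hgood q hq
    rw [hcount] at h1
    have h5 : D.card = (Rᶜ ∩ D).card + (R ∩ D).card := by
      rw [Finset.inter_comm, Finset.inter_comm R, ← Finset.sdiff_eq_inter_compl, add_comm,
        Finset.card_inter_add_card_sdiff]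
    -- The slack `N Δ` in the threshold pays for twice the deviation `N Δ / 2`.
    have h6 : 2 * ((Rᶜ ∩ D).card : ℝ) ≤ D.card := by linarith
    have h7 : 2 * (Rᶜ ∩ D).card ≤ D.card := by exact_mod_cast h6
    rw [hsplit, hsplit]
    omega

/-! ### Feasibility of non-negative polynomials -/

/-- On outputs, feasible polynomials have a small sum. -/
theorem IsOutput.sum_le {N d k : ℕ} {ε : ℝ} {ref inp : Sample N d} {T : Finset (Fin N)}
    (hN : 0 < N) (hT : IsOutput k ε ref inp T) {p : CubePoly d}
    (hp : IsFeasible k ε ref inp p) : ∑ i ∈ T, evalAt p (inp i) ≤ ε * N := by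
  obtain ⟨-, -, -, q, hq, hscore⟩ := hT
  refine (hq.2 p hp).trans ?_
  have hN' : (0 : ℝ) < N := by exact_mod_cast hN
  rwa [score, one_div, inv_mul_le_iff₀ hN', mul_comm] at hscore

/-- Non-negative polynomials with a small mean are feasible if the reference sample balances the
low-degree monomials. -/
theorem isFeasible_of_balanced {N d k : ℕ} {ε : ℝ} (hε : 0 < ε) (hε1 : ε < 1) (hN : 0 < N)
    (hd : 0 < d ∨ k = 0) {ref inp : Sample N d}
    (href : ∀ I ∈ (lowMonomials d k).erase ∅,
      |∑ i, monomialAt I (ref i)| ≤ N * (1 / (2 * coefBound d k)))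
    {p : CubePoly d} (hp : DegLE k p) (h0 : ∀ x, 0 ≤ evalAt p x) (hmean : unifMean p ≤ ε / 8) :
    IsFeasible k ε ref inp p := by
  have hB : 0 ≤ coefBound d k := coefBound_nonneg d k
  have hm0 : 0 ≤ unifMean p := div_nonneg (Finset.sum_nonneg fun x _ => h0 x) (card_cube_pos d).le
  -- At most `2 d^k` monomials occur, so the squared norm is at most `2 B² (ε/8)² = B² ε² / 32`.
  have hcoef : coefNorm p ≤ coefBound d k * (ε / 4) := by
    refine abs_le_of_sq_le_sq' ?_ (by positivity) |>.2
    refine (coefNorm_sq_le hp h0).trans ?_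
    rw [mul_pow, coefBound_sq]
    have hc := card_lowMonomials_le hd
    calc _ ≤ (2 * (d : ℝ) ^ k) * (9 ^ k * (ε / 8) ^ 2) := by gcongr
      _ = 9 ^ k * (d : ℝ) ^ k * (ε ^ 2 / 32) := by ring
      _ ≤ 9 ^ k * (d : ℝ) ^ k * (ε / 4) ^ 2 := by
        gcongr
        nlinarith [sq_nonneg ε]
  refine ⟨hp, hcoef.trans (mul_le_of_le_one_right hB (by linarith)), fun i => h0 _, fun i => h0 _,
    ?_⟩
  refine (mean_le_of_balanced hp hN href (by positivity)).trans ?_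
  have h1 : coefNorm p * (1 / (2 * coefBound d k)) ≤ ε / 8 := by
    rcases hB.eq_or_lt with h | h
    · rw [← h, mul_zero, div_zero, mul_zero]
      positivity
    · refine (mul_le_mul_of_nonneg_right hcoef (by positivity)).trans (le_of_eq ?_)
      field_simp
      norm_num
  linarith

/-! ### Sample size and the zero-dimensional case -/

theorem one_sub_le_unifProb_of_forall {Ω : Type} [Fintype Ω] [Nonempty Ω] {E : Ω → Prop} {δ : ℝ}
    (hδ : 0 ≤ δ) (h : ∀ ω, E ω) : 1 - δ ≤ unifProb E := by
  refine one_sub_le_unifProb ?_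
  have : IsEmpty {ω // ¬ E ω} := ⟨fun ω => ω.2 (h ω.1)⟩
  rw [Nat.card_of_isEmpty, Nat.cast_zero]
  positivity

/-- The consequences of the sample size for the two concentration bounds. -/
theorem sample_size_bounds {d N k : ℕ} {ε M : ℝ} (hε : 0 < ε) (hε1 : ε < 1) (hM : 1 ≤ M)
    (hd : 0 < d ∨ k = 0)
    (hN : 40000 * ((3 * (d : ℝ)) ^ (2 * k) / ε ^ 2) * M ≤ (N : ℝ)) :
    0 < N ∧ 1152 * (lowMonomials d k).card * M ≤ N * (slack d k ε / 2) ^ 2 ∧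
      2 * (d : ℝ) ^ k * Real.exp (-((N * (1 / (2 * coefBound d k))) ^ 2 / (2 * N)))
        ≤ Real.exp (-M) := by
  have hD : (1 : ℝ) ≤ (d : ℝ) ^ k := by
    rcases hd with h | rfl
    · exact one_le_pow₀ (by exact_mod_cast h)
    · simp
  have hB2 := coefBound_sq d k
  have hcard := card_lowMonomials_le hd
  have e3 : (3 * (d : ℝ)) ^ (2 * k) = 9 ^ k * ((d : ℝ) ^ k) ^ 2 := by
    rw [mul_pow, pow_mul 3, mul_comm 2 k, pow_mul (d : ℝ)]
    norm_num
  rw [e3] at hN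
  generalize (d : ℝ) ^ k = D at *
  have h9 : (0 : ℝ) < 9 ^ k := by positivity
  generalize (9 : ℝ) ^ k = P at *
  have hD0 : 0 < D := by linarith
  have hM0 : 0 < M := by linarith
  have hBpos : 0 < coefBound d k :=
    (coefBound_nonneg d k).lt_of_ne fun h => by
      rw [← h] at hB2
      have := mul_pos h9 hD0
      rw [← hB2] at this
      norm_num at this
  have hNpos : (0 : ℝ) < N := lt_of_lt_of_le (by positivity) hN
  have hα : (slack d k ε / 2) ^ 2 = ε ^ 2 / (16 * (P * D)) := by
    rw [← hB2, slack]
    field_simp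
    norm_num
  have hβ : (N * (1 / (2 * coefBound d k))) ^ 2 / (2 * N) = N / (8 * (P * D)) := by
    rw [← hB2]
    field_simp
    norm_num
  refine ⟨by exact_mod_cast hNpos, ?_, ?_⟩
  · rw [hα]
    -- This step fixes the constant: `2 · 1152 ≤ 2500 = 40000 / 16`.
    calc 1152 * ((lowMonomials d k).card : ℝ) * M ≤ 1152 * (2 * D) * M := by gcongr
      _ ≤ 2500 * D * M := by nlinarith [mul_pos hD0 hM0]
      _ = 40000 * (P * D ^ 2 / ε ^ 2) * M * (ε ^ 2 / (16 * (P * D))) := by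
        field_simp
        norm_num
      _ ≤ _ := by gcongr
  · rw [hβ]
    have h1 : 5000 * D * M ≤ N / (8 * (P * D)) := by
      rw [le_div_iff₀ (by positivity)]
      refine le_trans ?_ hN
      have : P * D ^ 2 ≤ P * D ^ 2 / ε ^ 2 := by
        rw [le_div_iff₀ (by positivity)]
        exact mul_le_of_le_one_right (by positivity) (by nlinarith)
      calc 5000 * D * M * (8 * (P * D)) = 40000 * (P * D ^ 2) * M := by ring
        _ ≤ _ := by gcongr
    have h2 : 2 * D ≤ Real.exp (2 * D) := by
      have := Real.add_one_le_exp (2 * D)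
      linarith
    calc _ ≤ Real.exp (2 * D) * Real.exp (-(N / (8 * (P * D)))) := by gcongr
      _ = Real.exp (2 * D + -(N / (8 * (P * D)))) := (Real.exp_add _ _).symm
      _ ≤ _ := by
        gcongr
        nlinarith [mul_pos hD0 hM0]

theorem exp_neg_max_le {δ : ℝ} (hδ : 0 < δ) : Real.exp (-max 1 (Real.log (1 / δ))) ≤ δ := by
  calc _ ≤ Real.exp (-Real.log (1 / δ)) := by
        gcongr
        exact le_max_right _ _
    _ = δ := by rw [one_div, Real.log_inv, neg_neg, Real.exp_log hδ]

theorem evalAt_eq_unifMean {p : CubePoly 0} (x : Cube 0) : evalAt p x = unifMean p := by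
  rw [unifMean_eq, evalAt_eq_sum, Fintype.sum_eq_single ∅]
  · simp [monomialAt]
  · intro I hI
    exact absurd (Finset.eq_empty_of_isEmpty I) hI

end OutlierRemoval

open OutlierRemoval in
theorem mainTheorem2 :
    ∃ C : ℝ, 1 ≤ C ∧
      ∀ (d N k : ℕ) (ε δ η : ℝ), 0 < ε → ε < 1 → 0 < δ → δ < 1 → 0 < η → η < 1 →
        C * ((3 * (d : ℝ)) ^ (2 * k) / ε ^ 2) * max 1 (Real.log (1 / δ)) ≤ (N : ℝ) →
        (∀ ref inp : OutlierRemoval.Sample N d, OutlierRemoval.AlwaysOutputs k ε ref inp) ∧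
        -- `ω.1` is the clean sample and `ω.2` the independent reference sample
        1 - δ ≤ OutlierRemoval.unifProb
          (fun ω : OutlierRemoval.Sample N d × OutlierRemoval.Sample N d =>
            ∀ (R : Finset (Fin N)) (inp : OutlierRemoval.Sample N d),
              OutlierRemoval.IsContamination η ω.1 R inp →
              ∀ T : Finset (Fin N), OutlierRemoval.IsOutput k ε ω.2 inp T →
                (Rᶜ \ T).card ≤ (R \ T).card) ∧
        1 - δ ≤ OutlierRemoval.unifProb
          (fun ω : OutlierRemoval.Sample N d × OutlierRemoval.Sample N d =>
            ∀ (R : Finset (Fin N)) (inp : OutlierRemoval.Sample N d),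
              OutlierRemoval.IsContamination η ω.1 R inp →
              ∀ T : Finset (Fin N), OutlierRemoval.IsOutput k ε ω.2 inp T →
                ∀ p : OutlierRemoval.CubePoly d, OutlierRemoval.DegLE k p →
                  (∀ x, 0 ≤ OutlierRemoval.evalAt p x) →
                  OutlierRemoval.unifMean p ≤ ε / 8 →
                  ∑ i ∈ T, OutlierRemoval.evalAt p (inp i) ≤ ε * (N : ℝ)) := by
  refine ⟨40000, by norm_num, fun d N k ε δ η hε hε1 hδ _ _ _ hN =>
    ⟨fun ref inp => alwaysOutputs k hε ref inp, ?_, ?_⟩⟩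
  · refine le_trans ?_ (unifProb_mono (E := fun ω : Sample N d × Sample N d =>
      ∀ q : CubePoly d, DegLE k q →
        posCount q ω.1 ≤ posCount q ω.2 + N * (slack d k ε / 2)) ?_)
    · have hs := slack_nonneg d k hε.le
      -- In the excluded case `d = 0 < k` the required sample size is 0, so concentration is
      -- unavailable; but the cube is a single point and both samples coincide.
      by_cases hd : 0 < d ∨ k = 0
      · obtain ⟨-, h1, -⟩ := sample_size_bounds hε hε1 (le_max_left _ _) hd hN
        refine one_sub_le_unifProb ((card_posCount_lt_le (by positivity) (le_max_left _ _)
          h1).trans ?_)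
        gcongr
        exact exp_neg_max_le hδ
      · obtain rfl : d = 0 := by omega
        refine one_sub_le_unifProb_of_forall hδ.le fun ω q _ => ?_
        rw [Subsingleton.elim ω.1 ω.2]
        exact le_add_of_nonneg_right (by positivity)
    · rintro ω hω R inp hcont T ⟨i, -, hi, -⟩
      exact hi.card_clean_le hε hω hcont
  · by_cases hd : 0 < d ∨ k = 0
    · obtain ⟨hNpos, -, h2⟩ := sample_size_bounds hε hε1 (le_max_left _ _) hd hN
      have hB := coefBound_nonneg d k
      refine le_trans ?_ (unifProb_mono (E := fun ω : Sample N d × Sample N d =>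
        ∀ I ∈ (lowMonomials d k).erase ∅,
          |∑ i, monomialAt I (ω.2 i)| ≤ N * (1 / (2 * coefBound d k))) ?_)
      · refine one_sub_le_unifProb ?_
        rw [card_snd_not (A := Sample N d) (fun y : Sample N d =>
          ∀ I ∈ (lowMonomials d k).erase ∅,
            |∑ i, monomialAt I (y i)| ≤ N * (1 / (2 * coefBound d k))), Fintype.card_prod]
        push_cast
        rw [mul_assoc]
        gcongr
        refine (card_not_balanced_le (by positivity) hNpos).trans ?_
        gcongr
        exact h2.trans (exp_neg_max_le hδ)
      · intro ω hω R inp _ T hT p hp h0 hmean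
        exact hT.sum_le hNpos (isFeasible_of_balanced hε hε1 hNpos hd hω hp h0 hmean)
    · obtain rfl : d = 0 := by omega
      -- On a one-point cube `p` is the constant `unifMean p ≤ ε / 8`, so summing over at most `N`
      -- examples suffices.
      refine one_sub_le_unifProb_of_forall hδ.le fun ω R inp _ T _ p _ h0 hmean => ?_
      have hm0 : 0 ≤ unifMean p := by
        rw [← evalAt_eq_unifMean default]
        exact h0 _
      have hT : (T.card : ℝ) ≤ N := by exact_mod_cast card_finset_fin_le T
      simp only [evalAt_eq_unifMean, Finset.sum_const, nsmul_eq_mul]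
      calc (T.card : ℝ) * unifMean p ≤ N * ε := by gcongr; linarith
        _ = _ := mul_comm _ _
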